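/- Let $k\in\mathbb Z^n$, $c\in\mathbb Z$, and let $t$ be a transition of a Petri net with $n$ places, given by vectors $t^-,t^+\in\mathbb N^n$ (tokens consumed and produced by $t$ in each place). The half space $(k,c)$ is called $t$-inductive if for every marking $m\in\mathbb N^n$ with $m\ge t^-$ and $k\cdot m\ge c$ one also has $k\cdot(m+t^+-t^-)\ge c$. The inductivity problem is: given $(k,c)$ and $t$, decide whether $(k,c)$ is $t$-inductive. An instance is presented as a word over a fixed finite alphabet that lists the numbers $c$ and $k(i),t^-(i),t^+(i)$ for $i=1,\dots,n$, all in unary or all in binary (with a minus sign for negative numbers and a mark at the end of each number); the problem is identified with the language of the encodings of its yes-instances. Let $\mathbf L$ be the class of languages decided by deterministic Turing machines (with a read-only input tape and work tapes) in space $O(\log \ell)$, where $\ell$ is the length of the input; let $\mathbf{NL}$ be the class of languages accepted by nondeterministic such machines in space $O(\log \ell)$; let $\mathbf{CSL}$ be the class of languages accepted by nondeterministic such machines in space $O(\ell)$; and for a class $\mathbf C$ let $\textbf{co-}\mathbf C$ be the class of complements of languages in $\mathbf C$. Then: 1. for every fixed dimension $n\ge 0$, the inductivity problem in dimension $n$ with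 unary encoded input is in $\mathbf L$; 2. the inductivity problem (with $n$ part of the input) with unary encoded input is in $\textbf{co-}\mathbf{NL}$; 3. the inductivity problem (with $n$ part of the input) with binary encoded input is in $\textbf{co-}\mathbf{CSL}$. -/

import Mathlib

/-! ### Petri nets and inductive half spaces -/

/-- A Petri net with places `P` and transitions `T`: `flowIn p t` is the value of the flow function
on `(p, t)` and `flowOut t p` is its value on `(t, p)`. -/
structure PetriNet (P T : Type) where
  flowIn : P → T → ℕ
  flowOut : T → P → ℕ

namespace PetriNet

variable {P T : Type}

/-- The vector `t⁻`. -/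
def pre (N : PetriNet P T) (t : T) : P → ℕ := fun p => N.flowIn p t

/-- The vector `t⁺`. -/
def post (N : PetriNet P T) (t : T) : P → ℕ := fun p => N.flowOut t p

/-- The vector `t^Δ = t⁺ - t⁻`. -/
def delta (N : PetriNet P T) (t : T) : P → ℤ := fun p => (N.post t p : ℤ) - (N.pre t p : ℤ)

/-- The activation space of `t`: all markings that enable `t`. -/
def activationSpace (N : PetriNet P T) (t : T) : Set (P → ℕ) := {m | ∀ p, N.pre t p ≤ m p}

/-- The half space `(k, c)`: all integer vectors `m` with `k · m ≥ c`. -/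
def halfSpace [Fintype P] (k : P → ℤ) (c : ℤ) : Set (P → ℤ) := {m | c ≤ ∑ p, k p * m p}

/-- The half space `(k, c)` is `t`-inductive: firing `t` does not leave it. -/
def IsTInductive [Fintype P] (N : PetriNet P T) (t : T) (k : P → ℤ) (c : ℤ) : Prop :=
  ∀ m ∈ N.activationSpace t, (fun p => (m p : ℤ)) ∈ halfSpace k c →
    (fun p => (m p : ℤ) + N.delta t p) ∈ halfSpace k c

end PetriNet

/-! ### Instances of the inductivity problem and their encodings -/

/-- An instance of the inductivity problem with `n` places: a half space `(k, c)` and a transition,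
given by the two vectors `t⁻` and `t⁺`. -/
structure InductivityInstance (n : ℕ) where
  k : Fin n → ℤ
  c : ℤ
  tPre : Fin n → ℕ
  tPost : Fin n → ℕ

namespace InductivityInstance

/-- The Petri net that consists of the transition of the instance. -/
def net {n : ℕ} (I : InductivityInstance n) : PetriNet (Fin n) Unit where
  flowIn p _ := I.tPre p
  flowOut _ p := I.tPost p

/-- The answer to the instance is yes: its half space is inductive for its transition. -/
def IsYes {n : ℕ} (I : InductivityInstance n) : Prop := I.net.IsTInductive () I.k I.c

end InductivityInstance

/-- The input alphabet: two digits, a minus sign, and an end-of-number mark. -/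
inductive InSym where
  | zero
  | one
  | minus
  | sep
  deriving DecidableEq

/-- The unary representation of `m`: the digit `one`, repeated `m` times. -/
def unaryDigits (m : ℕ) : List InSym := List.replicate m InSym.one

/-- The binary representation of `m`, least significant digit first, without superfluous zeros. -/
def binaryDigits (m : ℕ) : List InSym := m.bits.map fun b => if b then InSym.one else InSym.zero

/-- A natural number is written as its digits and an end mark. -/
def encodeNatural (digits : ℕ → List InSym) (m : ℕ) : List InSym := digits m ++ [InSym.sep]

/-- An integer is written as a minus sign (if it is negative), the digits of its absolute value and
an end mark. -/
def encodeInteger (digits : ℕ → List InSym) (z : ℤ) : List InSym :=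
  (if z < 0 then [InSym.minus] else []) ++ encodeNatural digits z.natAbs

/-- The encoding of an instance: the constant `c`, and then `k(i)`, `t⁻(i)`, `t⁺(i)` for each
place `i`. -/
def InductivityInstance.encode (digits : ℕ → List InSym) {n : ℕ} (I : InductivityInstance n) :
    List InSym :=
  encodeInteger digits I.c ++
    (List.ofFn fun i : Fin n => encodeInteger digits (I.k i) ++
      (encodeNatural digits (I.tPre i) ++ encodeNatural digits (I.tPost i))).flatten

/-- The inductivity problem in the fixed dimension `n`, as a language. -/
def inductivityLanguageOfDim (digits : ℕ → List InSym) (n : ℕ) : Language InSym :=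
  {w | ∃ I : InductivityInstance n, I.IsYes ∧ I.encode digits = w}

/-- The inductivity problem (in all dimensions), as a language. -/
def inductivityLanguage (digits : ℕ → List InSym) : Language InSym :=
  {w | ∃ (n : ℕ) (I : InductivityInstance n), I.IsYes ∧ I.encode digits = w}

/-! ### Turing machines with a read-only input tape, and space-bounded classes -/

/-- A move of a head. -/
inductive HeadMove where
  | left
  | stay
  | right

/-- The content of a cell of the input tape: a letter or one of the two end marks. -/
inductive InputCell (α : Type) where
  | leftEnd
  | letter (a : α)
  | rightEnd

/-- One possible action of a machine with `r` work tapes: the next state, the symbols written on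
the work tapes, and the moves of the heads. -/
structure TMAction (Q Γ : Type) (r : ℕ) where
  next : Q
  write : Fin r → Γ
  moveIn : HeadMove
  moveWork : Fin r → HeadMove

/-- A nondeterministic Turing machine with a two-way read-only input tape and a finite number of
work tapes, each of them infinite to the right. -/
structure OfflineTM (α : Type) where
  Q : Type
  Γ : Type
  finite_Q : Finite Q
  finite_Γ : Finite Γ
  tapes : ℕ
  blank : Γ
  start : Q
  accept : Set Q
  trans : Q → InputCell α → (Fin tapes → Γ) → Set (TMAction Q Γ tapes)

/-- The next position of a head on a tape whose leftmost cell is cell `0`. -/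
def HeadMove.apply : HeadMove → ℕ → ℕ
  | .left, p => p - 1
  | .stay, p => p
  | .right, p => p + 1

/-- The input tape for `w`: cell `0` holds the left end mark, cells `1, …, |w|` hold the letters,
and cell `|w| + 1` holds the right end mark. -/
def inputCellAt {α : Type} (w : List α) : ℕ → InputCell α
  | 0 => .leftEnd
  | p + 1 => match w[p]? with
    | some a => .letter a
    | none => .rightEnd

namespace OfflineTM

variable {α : Type}

/-- A configuration of the machine. -/
structure Config (M : OfflineTM α) where
  state : M.Q
  posIn : ℕ
  tape : Fin M.tapes → ℕ → M.Γ
  pos : Fin M.tapes → ℕ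

/-- The initial configuration. -/
def init (M : OfflineTM α) : M.Config where
  state := M.start
  posIn := 0
  tape _ _ := M.blank
  pos _ := 0

/-- The configuration after an action. The input head never leaves the cells `0, …, |w| + 1`. -/
def doAction (M : OfflineTM α) (w : List α) (C : M.Config) (a : TMAction M.Q M.Γ M.tapes) :
    M.Config where
  state := a.next
  posIn := min (a.moveIn.apply C.posIn) (w.length + 1)
  tape i := Function.update (C.tape i) (C.pos i) (a.write i)
  pos i := (a.moveWork i).apply (C.pos i)

/-- The actions that are possible in a configuration. -/
def actions (M : OfflineTM α) (w : List α) (C : M.Config) : Set (TMAction M.Q M.Γ M.tapes) :=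
  M.trans C.state (inputCellAt w C.posIn) fun i => C.tape i (C.pos i)

/-- The one-step relation on input `w`. -/
def Step (M : OfflineTM α) (w : List α) (C D : M.Config) : Prop :=
  ∃ a ∈ M.actions w C, D = M.doAction w C a

/-- `C` occurs in some computation on input `w`. -/
def Reachable (M : OfflineTM α) (w : List α) (C : M.Config) : Prop :=
  Relation.ReflTransGen (M.Step w) M.init C

/-- No action is possible in `C`. -/
def Halted (M : OfflineTM α) (w : List α) (C : M.Config) : Prop := M.actions w C = ∅

/-- Some computation on `w` halts in an accepting state. -/
def Accepts (M : OfflineTM α) (w : List α) : Prop :=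
  ∃ C : M.Config, M.Reachable w C ∧ M.Halted w C ∧ C.state ∈ M.accept

/-- The language accepted by the machine. -/
def language (M : OfflineTM α) : Language α := {w | M.Accepts w}

/-- At most one action is possible at any time. -/
def Deterministic (M : OfflineTM α) : Prop := ∀ q a g, (M.trans q a g).Subsingleton

/-- Some computation on `w` halts (for a deterministic machine: the computation on `w` halts). -/
def HaltsOn (M : OfflineTM α) (w : List α) : Prop :=
  ∃ C : M.Config, M.Reachable w C ∧ M.Halted w C

/-- The machine works in space `O(s)`: in every computation on an input of length `ℓ`, each work
head stays within the first `B * s ℓ + B` cells of its tape, for a constant `B`. -/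
def RunsInSpace (M : OfflineTM α) (s : ℕ → ℕ) : Prop :=
  ∃ B : ℕ, ∀ (w : List α) (C : M.Config), M.Reachable w C →
    ∀ i, C.pos i < B * s w.length + B

end OfflineTM

/-- The languages decided by deterministic machines in space `O(s)`. -/
def DSPACE (α : Type) (s : ℕ → ℕ) : Set (Language α) :=
  {A | ∃ M : OfflineTM α, M.Deterministic ∧ (∀ w, M.HaltsOn w) ∧ M.RunsInSpace s ∧ M.language = A}

/-- The languages accepted by nondeterministic machines in space `O(s)`. -/
def NSPACE (α : Type) (s : ℕ → ℕ) : Set (Language α) :=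
  {A | ∃ M : OfflineTM α, M.RunsInSpace s ∧ M.language = A}

/-- The class L. -/
def classL (α : Type) : Set (Language α) := DSPACE α (Nat.log 2)

/-- The class NL. -/
def classNL (α : Type) : Set (Language α) := NSPACE α (Nat.log 2)

/-- The class CSL, as the class of the problems that can be solved nondeterministically in linear
space. -/
def classCSL (α : Type) : Set (Language α) := NSPACE α fun ℓ => ℓ

/-- The class of the complements of the languages in a class. -/
def coClass {α : Type} (K : Set (Language α)) : Set (Language α) := {A | Aᶜ ∈ K}

/-! Write a marking that enables t as m = x + t⁻ with x ≥ 0. The half space fails to be t-inductive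
iff some x ∈ ℕⁿ satisfies c − k·t⁻ ≤ k·x < c − k·t⁺ (`InductivityInstance.not_isYes_iff`). If such
an x exists, then one with minimal coordinate sum is small (`exists_small_combination`): for k(i) >
0 > k(j), taking |k(j)| from x(i) and |k(i)| from x(j) does not change k·x, so by minimality the
coordinates that belong to one sign of k are at most max |k|, and the ends of the interval then
control the others. Let L be ℓ + 1 for unary and 2^ℓ for binary input. It bounds n and all numbers
in the input, and x(i) ≤ 3L³ follows (`InductivityInstance.exists_small_refutes`). Such
multiplicities have O(log ℓ) digits for unary and O(ℓ) digits for binary input.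

A given x is tested in one scan of the input with finitely many registers: the digits arrive least
significant first, so products are formed by shifting and adding, and x(i) is needed only while k(i)
is being read (`evalWord_encode`). The registers never exceed 3L⁴ (`RegBound`). The same scan
recognises words that encode no instance (`foldl_nextState_eq_finalState`); these belong to the
complement.

Guessing x(i) when place i begins accepts the complement in logarithmic or linear space
(`GuessMode.compl_languageOf_mem`). For fixed n all of x fits on n tracks of the work tape, and a
counter runs deterministically through all contents of the tracks (`GuessMode.languageOf_mem`). One
machine covers both cases. Its work tape is a word of columns with a base 64 digit of every register
and track, rewritten by finite transducers in sweeps. The relation `Exact` follows all branches of a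
computation at once, and acceptance, halting and space are all read off from it. -/

/-! ### Exact sets of successors -/

namespace OfflineTM

variable {α : Type} (M : OfflineTM α) (w : List α) (b : ℕ)

/-- Every configuration in `S` can be reached from `C`, and every configuration that can be reached
from `C` either lies before `S`, and then it is not halted and its work heads are in the first `b`
cells, or can be reached from `S`. -/
def Exact (C : M.Config) (S : Set M.Config) : Prop :=
  (∀ D ∈ S, Relation.ReflTransGen (M.Step w) C D) ∧
    ∀ D, Relation.ReflTransGen (M.Step w) C D →
      ((∀ i, D.pos i < b) ∧ ¬ M.Halted w D) ∨ ∃ E ∈ S, Relation.ReflTransGen (M.Step w) E D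

variable {M w b}

theorem Exact.refl (C : M.Config) : M.Exact w b C {C} :=
  ⟨fun D hD => by rw [Set.mem_singleton_iff.1 hD], fun D hD => Or.inr ⟨C, rfl, hD⟩⟩

/-- Indexing the intermediate set by `ι` gives each branch its own continuation. -/
theorem Exact.bind {ι : Type*} {C : M.Config} {p : ι → Prop} {f : ι → M.Config}
    {T : ι → Set M.Config} (h : M.Exact w b C {D | ∃ i, p i ∧ D = f i})
    (hT : ∀ i, p i → M.Exact w b (f i) (T i)) :
    M.Exact w b C {E | ∃ i, p i ∧ E ∈ T i} := by
  refine ⟨?_, fun D hD => ?_⟩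
  · rintro E ⟨i, hi, hE⟩
    exact (h.1 _ ⟨i, hi, rfl⟩).trans ((hT i hi).1 E hE)
  · rcases h.2 D hD with h1 | ⟨_, ⟨i, hi, rfl⟩, hED⟩
    · exact Or.inl h1
    · rcases (hT i hi).2 D hED with h1 | ⟨F, hF, hFD⟩
      · exact Or.inl h1
      · exact Or.inr ⟨F, ⟨i, hi, hF⟩, hFD⟩

theorem Exact.trans_singleton {C D : M.Config} {S : Set M.Config}
    (h : M.Exact w b C {D}) (hD : M.Exact w b D S) : M.Exact w b C S := by
  have h1 : M.Exact w b C {E | ∃ _ : Unit, True ∧ E = D} := by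
    convert h using 1
    ext E
    simp
  convert h1.bind (T := fun _ => S) (fun _ _ => hD) using 1
  ext E
  simp

theorem Exact.step {C : M.Config} (hb : ∀ i, C.pos i < b) (hne : (M.actions w C).Nonempty) :
    M.Exact w b C (M.doAction w C '' M.actions w C) := by
  refine ⟨?_, fun D hD => ?_⟩
  · rintro D ⟨a, ha, rfl⟩
    exact .single ⟨a, ha, rfl⟩
  · rcases hD.cases_head with rfl | ⟨E, ⟨a, ha, rfl⟩, hE⟩
    · exact Or.inl ⟨hb, hne.ne_empty⟩
    · exact Or.inr ⟨_, ⟨a, ha, rfl⟩, hE⟩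

theorem Exact.step_singleton {C : M.Config} {a : TMAction M.Q M.Γ M.tapes} {S : Set M.Config}
    (hb : ∀ i, C.pos i < b) (ha : M.actions w C = {a}) (h : M.Exact w b (M.doAction w C a) S) :
    M.Exact w b C S := by
  have := Exact.step (w := w) hb (by rw [ha]; exact Set.singleton_nonempty a)
  rw [ha, Set.image_singleton] at this
  exact this.trans_singleton h

theorem Halted.eq_of_reachable {C D : M.Config} (hC : M.Halted w C)
    (h : Relation.ReflTransGen (M.Step w) C D) : D = C := by
  rcases h.cases_head with rfl | ⟨E, ⟨a, ha, -⟩, -⟩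
  · rfl
  · rw [hC] at ha
    exact ha.elim

/-- A halted configuration cannot lie before `S`, so it is reachable from a member of `S`; this
member is halted too, and the two coincide. -/
theorem Exact.accepts_iff {S : Set M.Config} (h : M.Exact w b M.init S)
    (hS : ∀ D ∈ S, M.Halted w D) : M.Accepts w ↔ ∃ D ∈ S, D.state ∈ M.accept := by
  constructor
  · rintro ⟨C, hr, hh, ha⟩
    rcases h.2 C hr with h1 | ⟨E, hE, hEC⟩
    · exact (h1.2 hh).elim
    · rw [(hS E hE).eq_of_reachable hEC] at ha
      exact ⟨E, hE, ha⟩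
  · rintro ⟨D, hD, ha⟩
    exact ⟨D, h.1 D hD, hS D hD, ha⟩

theorem Exact.pos_lt {S : Set M.Config} (h : M.Exact w b M.init S)
    (hS : ∀ D ∈ S, M.Halted w D) (hS' : ∀ D ∈ S, ∀ i, D.pos i < b) {C : M.Config}
    (hC : M.Reachable w C) (i : Fin M.tapes) : C.pos i < b := by
  rcases h.2 C hC with h1 | ⟨E, hE, hEC⟩
  · exact h1.1 i
  · rw [(hS E hE).eq_of_reachable hEC]
    exact hS' E hE i

end OfflineTM

/-- The result of applying a transducer to a word of columns, with given choices. -/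
def runPass {S Ch Col : Type} (pass : S → Ch → Col → S × Col) :
    S → List (Ch × Col) → S × List Col
  | s, [] => (s, [])
  | s, x :: l => ((runPass pass (pass s x.1 x.2).1 l).1,
      (pass s x.1 x.2).2 :: (runPass pass (pass s x.1 x.2).1 l).2)

/-! ### Machines that sweep over a tape of columns -/

/-- A machine whose work tape is a finite word of columns. In each round it reads its input cell,
moves its input head, and rewrites all columns from left to right by a finite transducer, which may
make choices and may append a column. -/
structure PassMachine (α : Type) where
  Q : Type
  Col : Type
  S : Type
  Ch : Type
  finite_Q : Finite Q
  finite_Col : Finite Col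
  finite_S : Finite S
  nonempty_Ch : Nonempty Ch
  start : Q
  accept : Set Q
  launch : Q → InputCell α → Option (S × HeadMove)
  pass : S → Ch → Col → S × Col
  extend : S → Option Col
  finish : S → Q

namespace PassMachine

/-- The states of the Turing machine: between two rounds, during a sweep, and on the way back. -/
inductive Phase (Q S : Type) where
  | idle (q : Q)
  | sweep (s : S)
  | back (q : Q)

instance {Q S : Type} [Finite Q] [Finite S] : Finite (Phase Q S) :=
  Finite.of_injective
    (fun p : Phase Q S => match p with
      | .idle q => (Sum.inl q : Q ⊕ S ⊕ Q)
      | .sweep s => Sum.inr (Sum.inl s)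
      | .back q => Sum.inr (Sum.inr q))
    (by rintro (_ | _ | _) (_ | _ | _) h <;> simp_all)

variable {α : Type} (P : PassMachine α)

/-- The transitions of the Turing machine. The column tape is delimited by blanks. -/
def trans : Phase P.Q P.S → InputCell α → (Fin 1 → Option P.Col) →
    Set (TMAction (Phase P.Q P.S) (Option P.Col) 1)
  | .idle q, a, _ => {x | ∃ s mv, P.launch q a = some (s, mv) ∧
      x = ⟨.sweep s, fun _ => none, mv, fun _ => .right⟩}
  | .sweep s, _, g => match g 0 with
    | some c => Set.range fun ch =>
        ⟨.sweep (P.pass s ch c).1, fun _ => some (P.pass s ch c).2, .stay, fun _ => .right⟩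
    | none => {⟨.back (P.finish s), fun _ => P.extend s, .stay, fun _ => .left⟩}
  | .back q, _, g => match g 0 with
    | some c => {⟨.back q, fun _ => some c, .stay, fun _ => .left⟩}
    | none => {⟨.idle q, fun _ => none, .stay, fun _ => .stay⟩}

/-- The Turing machine. -/
def toTM : OfflineTM α where
  Q := Phase P.Q P.S
  Γ := Option P.Col
  finite_Q := by
    have := P.finite_Q
    have := P.finite_S
    infer_instance
  finite_Γ := by
    have := P.finite_Col
    infer_instance
  tapes := 1
  blank := none
  start := .idle P.start
  accept := {p | ∃ q ∈ P.accept, p = .idle q}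
  trans := P.trans

theorem toTM_deterministic [Subsingleton P.Ch] : P.toTM.Deterministic := by
  intro q a g
  change (P.trans q a g).Subsingleton
  cases q with
  | idle q =>
    rintro _ ⟨s, mv, h, rfl⟩ _ ⟨s', mv', h', rfl⟩
    rw [h] at h'
    simp only [Option.some.injEq, Prod.mk.injEq] at h'
    rw [h'.1, h'.2]
  | sweep s =>
    unfold trans
    dsimp only
    split
    · rintro _ ⟨x, rfl⟩ _ ⟨y, rfl⟩
      rw [Subsingleton.elim x y]
    · exact Set.subsingleton_singleton
  | back q =>
    unfold trans
    dsimp only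
    split <;> exact Set.subsingleton_singleton

/-- The work tape that holds a word of columns. -/
def tapeOf {Γ : Type} (cols : List Γ) : ℕ → Option Γ
  | 0 => none
  | j + 1 => cols[j]?

/-- A configuration with a given column tape. -/
def config (p : Phase P.Q P.S) (i : ℕ) (cols : List P.Col) (j : ℕ) : P.toTM.Config where
  state := p
  posIn := i
  tape _ := tapeOf cols
  pos _ := j

/-- An action of the Turing machine. -/
def act (p : Phase P.Q P.S) (c : Option P.Col) (mv mv' : HeadMove) :
    TMAction P.toTM.Q P.toTM.Γ P.toTM.tapes :=
  ⟨p, fun _ => c, mv, fun _ => mv'⟩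

theorem actions_config (w : List α) (p : Phase P.Q P.S) (i : ℕ) (cols : List P.Col) (j : ℕ) :
    P.toTM.actions w (P.config p i cols j) =
      P.trans p (inputCellAt w i) (fun _ => tapeOf cols j) :=
  rfl

theorem doAction_config (w : List α) (p p' : Phase P.Q P.S) (i : ℕ) (cols cols' : List P.Col)
    (j : ℕ) (c : Option P.Col) (mv mv' : HeadMove)
    (h : Function.update (tapeOf cols) j c = tapeOf cols') :
    P.toTM.doAction w (P.config p i cols j) (P.act p' c mv mv') =
      P.config p' (min (mv.apply i) (w.length + 1)) cols' (mv'.apply j) := by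
  unfold config
  rw [← h]
  rfl

theorem update_tapeOf_zero {Γ : Type} (u : List Γ) :
    Function.update (tapeOf u) 0 none = tapeOf u :=
  Function.update_eq_self 0 (tapeOf u)

theorem update_tapeOf_append {Γ : Type} (u : List Γ) (c c' : Γ) (v : List Γ) :
    Function.update (tapeOf (u ++ c :: v)) (u.length + 1) (some c') = tapeOf (u ++ c' :: v) := by
  funext j
  rcases j with _ | j
  · simp [tapeOf, Function.update]
  · by_cases h : j = u.length
    · subst h
      simp [tapeOf]
    · rw [Function.update_of_ne (by omega)]
      simp only [tapeOf, List.getElem?_append]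
      split_ifs with h1
      · rfl
      · obtain ⟨m, hm⟩ : ∃ m, j - u.length = m + 1 := ⟨j - u.length - 1, by omega⟩
        simp [hm]

theorem update_tapeOf_end {Γ : Type} (u : List Γ) (o : Option Γ) :
    Function.update (tapeOf u) (u.length + 1) o = tapeOf (u ++ o.toList) := by
  funext j
  rcases j with _ | j
  · simp [tapeOf, Function.update]
  · by_cases h : j = u.length
    · subst h
      cases o <;> simp [tapeOf]
    · rw [Function.update_of_ne (by omega)]
      simp only [tapeOf, List.getElem?_append]
      split_ifs with h1
      · rfl
      · rw [List.getElem?_eq_none (by omega), List.getElem?_eq_none]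
        cases o
        · simp
        · simp
          omega

variable {P} {w : List α} {b : ℕ}

theorem exact_back (q : P.Q) {i : ℕ} (hi : i ≤ w.length + 1) (cols : List P.Col) {j : ℕ}
    (hj : j ≤ cols.length) (hb : j < b) :
    P.toTM.Exact w b (P.config (.back q) i cols j) {P.config (.idle q) i cols 0} := by
  have hmin : min (HeadMove.stay.apply i) (w.length + 1) = i := min_eq_left hi
  induction j with
  | zero =>
    refine OfflineTM.Exact.step_singleton (a := P.act (.idle q) none .stay .stay)
      (fun _ => hb) rfl ?_
    rw [P.doAction_config w _ _ _ cols cols _ _ _ _ (update_tapeOf_zero cols),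
      hmin]
    exact OfflineTM.Exact.refl _
  | succ j ih =>
    have hcell : tapeOf cols (j + 1) = some (cols[j]) := by simp [tapeOf]
    refine OfflineTM.Exact.step_singleton
      (a := P.act (.back q) (tapeOf cols (j + 1)) .stay .left) (fun _ => hb) ?_ ?_
    · rw [actions_config, hcell]
      rfl
    · rw [P.doAction_config w _ _ _ cols cols _ _ _ _
        (Function.update_eq_self (j + 1) (tapeOf cols)), hmin]
      exact ih (by omega) (by omega)

/-- Here `u` is already rewritten and `v` is still to be read. A list `l` pairs each column of `v`
with the choice made there, so the lists `l` index the branches of the rest of the sweep. -/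
theorem exact_sweep (s : P.S) {i : ℕ} (hi : i ≤ w.length + 1) (u v : List P.Col)
    (hb : u.length + v.length + 1 < b) :
    P.toTM.Exact w b (P.config (.sweep s) i (u ++ v) (u.length + 1))
      {C | ∃ l : List (P.Ch × P.Col), l.map Prod.snd = v ∧
        C = P.config (.idle (P.finish (runPass P.pass s l).1)) i
          (u ++ (runPass P.pass s l).2 ++ (P.extend (runPass P.pass s l).1).toList) 0} := by
  have hmin : min (HeadMove.stay.apply i) (w.length + 1) = i := min_eq_left hi
  induction v generalizing s u with
  | nil =>
    have hcell : tapeOf (u ++ []) (u.length + 1) = none := by simp [tapeOf]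
    refine OfflineTM.Exact.step_singleton
      (a := P.act (.back (P.finish s)) (P.extend s) .stay .left)
      (fun _ => by simpa [config] using hb) ?_ ?_
    · rw [actions_config, hcell]
      rfl
    · rw [P.doAction_config w _ _ _ (u ++ []) (u ++ (P.extend s).toList) _ _ _ _
        (by rw [List.append_nil]; exact update_tapeOf_end u _), hmin]
      convert exact_back (w := w) (b := b) (P.finish s) hi (u ++ (P.extend s).toList)
        (j := u.length) (by simp) (by simp at hb; omega) using 1
      · rfl
      · ext C
        simp [runPass]
  | cons c v ih =>
    have hcell : tapeOf (u ++ c :: v) (u.length + 1) = some c := by simp [tapeOf]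
    have hact : P.toTM.actions w (P.config (.sweep s) i (u ++ c :: v) (u.length + 1)) =
        Set.range fun ch => P.act (.sweep (P.pass s ch c).1) (some (P.pass s ch c).2) .stay
          .right := by
      rw [actions_config, hcell]
      rfl
    have hne := P.nonempty_Ch
    have h1 := OfflineTM.Exact.step (M := P.toTM) (w := w) (b := b)
      (C := P.config (.sweep s) i (u ++ c :: v) (u.length + 1))
      (fun _ => by simp [config] at hb ⊢; omega)
      (by rw [hact]; exact Set.range_nonempty _)
    have hdo : ∀ ch, P.toTM.doAction w (P.config (.sweep s) i (u ++ c :: v) (u.length + 1))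
        (P.act (.sweep (P.pass s ch c).1) (some (P.pass s ch c).2) .stay .right) =
        P.config (.sweep (P.pass s ch c).1) i ((u ++ [(P.pass s ch c).2]) ++ v)
          ((u ++ [(P.pass s ch c).2]).length + 1) := by
      intro ch
      rw [P.doAction_config w _ _ _ _ ((u ++ [(P.pass s ch c).2]) ++ v) _ _ _ _
        (by rw [List.append_assoc]; exact update_tapeOf_append u c _ v), hmin,
        HeadMove.apply, List.length_append, List.length_singleton]
    have h2 : P.toTM.Exact w b (P.config (.sweep s) i (u ++ c :: v) (u.length + 1))
        {D | ∃ ch : P.Ch, True ∧ D = P.config (.sweep (P.pass s ch c).1) i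
          ((u ++ [(P.pass s ch c).2]) ++ v) ((u ++ [(P.pass s ch c).2]).length + 1)} := by
      convert h1 using 1
      rw [hact, ← Set.range_comp]
      ext D
      simp [hdo, eq_comm]
    convert h2.bind (fun ch _ => ih (P.pass s ch c).1 (u ++ [(P.pass s ch c).2])
      (by simp at hb ⊢; omega)) using 1
    ext C
    constructor
    · rintro ⟨l, hl, rfl⟩
      rcases l with _ | ⟨⟨ch, c'⟩, l⟩
      · simp at hl
      · simp only [List.map_cons, List.cons.injEq] at hl
        obtain ⟨rfl, rfl⟩ := hl
        exact ⟨ch, trivial, l, rfl, by simp [runPass]⟩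
    · rintro ⟨ch, -, l, hl, rfl⟩
      exact ⟨(ch, c) :: l, by simp [hl], by simp [runPass]⟩

/-- One round of the machine. -/
theorem exact_round {q : P.Q} {s : P.S} {mv : HeadMove} {i : ℕ} {cols : List P.Col}
    (h : P.launch q (inputCellAt w i) = some (s, mv)) (hb : cols.length + 1 < b) :
    P.toTM.Exact w b (P.config (.idle q) i cols 0)
      {C | ∃ l : List (P.Ch × P.Col), l.map Prod.snd = cols ∧
        C = P.config (.idle (P.finish (runPass P.pass s l).1)) (min (mv.apply i) (w.length + 1))
          ((runPass P.pass s l).2 ++ (P.extend (runPass P.pass s l).1).toList) 0} := by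
  refine OfflineTM.Exact.step_singleton (a := P.act (.sweep s) none mv .right)
    (fun _ => by simp only [config]; omega) ?_ ?_
  · rw [actions_config]
    ext x
    constructor
    · rintro ⟨s', mv', h', rfl⟩
      rw [h] at h'
      simp only [Option.some.injEq, Prod.mk.injEq] at h'
      rw [← h'.1, ← h'.2]
      rfl
    · rintro rfl
      exact ⟨s, mv, h, rfl⟩
  · rw [P.doAction_config w _ _ _ cols cols _ _ _ _ (update_tapeOf_zero cols)]
    have h1 := exact_sweep (w := w) (b := b) s (i := min (mv.apply i) (w.length + 1))
      (min_le_right _ _) [] cols (by simpa using hb)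
    simp only [List.nil_append, List.length_nil] at h1
    exact h1

theorem halted_config {q : P.Q} {i : ℕ} {cols : List P.Col}
    (h : P.launch q (inputCellAt w i) = none) :
    P.toTM.Halted w (P.config (.idle q) i cols 0) := by
  refine Set.eq_empty_iff_forall_notMem.2 ?_
  rintro x ⟨s, mv, h', -⟩
  cases h.symm.trans h'

theorem init_eq : P.toTM.init = P.config (.idle P.start) 0 [] 0 := by
  have : tapeOf ([] : List P.Col) = fun _ => none := by
    funext j
    cases j <;> rfl
  unfold config
  rw [this]
  rfl

theorem config_mem_accept {q : P.Q} {i : ℕ} {cols : List P.Col} {j : ℕ} :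
    (P.config (.idle q) i cols j).state ∈ P.toTM.accept ↔ q ∈ P.accept := by
  constructor
  · rintro ⟨q', h, h'⟩
    cases h'
    exact h
  · exact fun h => ⟨q, h, rfl⟩

end PassMachine

/-! ### Evaluating the encoding letter by letter -/

/-- The registers of the evaluation. `sum neg after` collects the negative or the positive terms of
the left hand side before or after firing; `coeff` and `weight` serve to read a coefficient;
`factor` is what the number that is being read is multiplied with. -/
inductive Reg where
  | sum (neg after : Bool)
  | coeff
  | weight
  | factor
  deriving Fintype

/-- A summand of a register update. -/
inductive Operand where
  | zero
  | guess
  | reg (r : Reg)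
  deriving Fintype

/-- A simultaneous update: each register becomes the sum of two operands and a bit. -/
abbrev RegOp := Reg → Operand × Operand × Bool

/-- The part of an instance to which a number belongs. -/
inductive EncField where
  | const
  | coeff
  | pre
  | post
  deriving DecidableEq

instance : Fintype EncField := ⟨{.const, .coeff, .pre, .post}, fun f => by cases f <;> simp⟩

/-- What has been read of the current number: nothing, only a minus sign, or its last digit. -/
inductive NumStatus where
  | fresh
  | minus
  | zero
  | one
  deriving DecidableEq

instance : Fintype NumStatus := ⟨{.fresh, .minus, .zero, .one}, fun s => by cases s <;> simp⟩

/-- The state of the parser. The Boolean is the sign of the current constant or coefficient. -/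
abbrev ParseState := Option (EncField × NumStatus × Bool)

def EncField.next : EncField → EncField
  | const => coeff
  | coeff => pre
  | pre => post
  | post => coeff

/-- The parser keeps the sign at the end of this field. -/
def EncField.keepsSign : EncField → Bool
  | coeff => true
  | pre => true
  | _ => false

/-- The numbers in this field contribute to the left hand side before or after firing. -/
def EncField.contributes : EncField → Bool → Bool
  | pre, after => !after
  | post, after => after
  | _, _ => true

def nextState (dbl : Bool) : ParseState → InSym → ParseState
  | none, _ => none
  | some (f, _, g), .zero => if dbl then some (f, .zero, g) else none
  | some (f, _, g), .one => some (f, .one, g)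
  | some (f, s, _), .minus =>
    if s = .fresh ∧ (f = .const ∨ f = .coeff) then some (f, .minus, true) else none
  | some (f, s, g), .sep =>
    if s = .fresh ∨ s = .one then some (f.next, .fresh, g && f.keepsSign) else none

/-- A new multiplicity is guessed when this letter is read. -/
def isGuess : ParseState → InSym → Bool
  | some (.const, _), .sep => true
  | some (.post, _), .sep => true
  | _, _ => false

def keepOp : RegOp := fun r => (.reg r, .zero, false)

def resetOp : RegOp
  | .sum _ _ => (.zero, .zero, false)
  | .coeff => (.zero, .zero, false)
  | .weight => (.zero, .zero, true)
  | .factor => (.zero, .zero, true)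

/-- The update for a digit; the constant enters with the opposite sign. -/
def digitOp (dbl : Bool) (f : EncField) (g d : Bool) : RegOp
  | .sum neg after => (.reg (.sum neg after),
      if d && (neg == (g ^^ decide (f = .const))) && f.contributes after then .reg .factor
      else .zero, false)
  | .coeff => (.reg .coeff, if d && decide (f = .coeff) then .reg .weight else .zero, false)
  | .weight => (.reg .weight, if dbl && decide (f = .coeff) then .reg .weight else .zero, false)
  | .factor => (.reg .factor, if dbl then .reg .factor else .zero, false)

/-- The update at the end of a number. -/
def sepOp : EncField → RegOp
  | .coeff, .factor => (.reg .coeff, .zero, false)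
  | .pre, .factor => (.reg .coeff, .zero, false)
  | _, .factor => (.guess, .zero, false)
  | .const, .coeff => (.zero, .zero, false)
  | .post, .coeff => (.zero, .zero, false)
  | .const, .weight => (.zero, .zero, true)
  | .post, .weight => (.zero, .zero, true)
  | _, r => keepOp r

def letterOp (dbl : Bool) : ParseState → InSym → RegOp
  | some (f, _, g), .zero => digitOp dbl f g false
  | some (f, _, g), .one => digitOp dbl f g true
  | some (f, _, _), .sep => sepOp f
  | _, _ => keepOp

def Operand.eval (V : Reg → ℕ) (x : ℕ) : Operand → ℕ
  | zero => 0
  | guess => x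
  | reg r => V r

def RegOp.eval (op : RegOp) (V : Reg → ℕ) (x : ℕ) : Reg → ℕ := fun r =>
  (op r).1.eval V x + (op r).2.1.eval V x + (op r).2.2.toNat

/-- The state of the evaluation: the parser, the number of guesses so far, and the registers. -/
abbrev EvalState := ParseState × ℕ × (Reg → ℕ)

/-- The evaluation of a word, where the successive guesses are given by `x`. -/
def evalWord (dbl : Bool) : List InSym → (ℕ → ℕ) → EvalState → EvalState
  | [], _, s => s
  | a :: u, x, s => evalWord dbl u (if isGuess s.1 a then fun i => x (i + 1) else x)
      (nextState dbl s.1 a, if isGuess s.1 a then s.2.1 + 1 else s.2.1,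
        (letterOp dbl s.1 a).eval s.2.2 (x 0))

def startState : ParseState := some (.const, .fresh, false)

def finalState : ParseState := some (.coeff, .fresh, false)

def startEval : EvalState := (startState, 0, resetOp.eval (fun _ => 0) 0)

/-- The value of the left hand side minus the constant. -/
def excess (V : Reg → ℕ) (after : Bool) : ℤ := (V (.sum false after) : ℤ) - V (.sum true after)

/-! ### Digit words and their values. -/

/-- The base of the number system. -/
def numBase (dbl : Bool) : ℕ := if dbl then 2 else 1

/-- Unary or binary digits. -/
def digitsOf (dbl : Bool) : ℕ → List InSym := if dbl then binaryDigits else unaryDigits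

def digitValue (dbl : Bool) : List InSym → ℕ
  | [] => 0
  | a :: u => (if a = .one then 1 else 0) + numBase dbl * digitValue dbl u

/-- The word completes a number without superfluous zeros, given the status before it. -/
def Completes (dbl : Bool) : NumStatus → List InSym → Prop
  | s, [] => s = .fresh ∨ s = .one
  | _, a :: u => (a = .one ∧ Completes dbl .one u) ∨ (a = .zero ∧ dbl ∧ Completes dbl .zero u)

/-- After a minus sign or a zero a digit one must still follow. The second conclusion records this;
the induction needs it because a zero may precede only the digits of a positive number. -/
theorem digitsOf_digitValue {dbl : Bool} {s : NumStatus} {u : List InSym}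
    (h : Completes dbl s u) : digitsOf dbl (digitValue dbl u) = u ∧
      (s = .minus ∨ s = .zero → 0 < digitValue dbl u) := by
  induction u generalizing s with
  | nil =>
    refine ⟨by cases dbl <;> simp [digitsOf, digitValue, binaryDigits, unaryDigits], ?_⟩
    rcases h with rfl | rfl <;> simp
  | cons a u ih =>
    rcases h with ⟨rfl, h⟩ | ⟨rfl, hd, h⟩
    · obtain ⟨h1, -⟩ := ih h
      refine ⟨?_, fun _ => by simp [digitValue]⟩
      cases dbl
      · have h3 : unaryDigits (digitValue false u) = u := h1
        simp only [unaryDigits] at h3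
        simp [digitsOf, unaryDigits, digitValue, numBase, List.replicate_add, h3]
      · simp only [digitsOf, binaryDigits, digitValue, numBase, if_true] at h1 ⊢
        rw [add_comm 1, Nat.bit1_bits, List.map_cons, h1]
        rfl
    · obtain ⟨h1, h2⟩ := ih h
      have h3 := h2 (Or.inr rfl)
      subst hd
      refine ⟨?_, fun _ => by simp [digitValue, numBase, h3]⟩
      simp only [digitsOf, binaryDigits, digitValue, numBase, if_true] at h1 ⊢
      simp only [reduceCtorEq, if_false, zero_add]
      rw [Nat.bit0_bits _ h3.ne', List.map_cons, h1]
      rfl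

theorem completes_digitsOf (dbl : Bool) (s : NumStatus) (m : ℕ)
    (h : 0 < m ∨ s = .fresh ∨ s = .one) : Completes dbl s (digitsOf dbl m) := by
  cases dbl
  · induction m generalizing s with
    | zero => simpa [digitsOf, unaryDigits, Completes] using h
    | succ m ih => exact Or.inl ⟨rfl, ih .one (by simp)⟩
  · induction m using Nat.binaryRec' generalizing s with
    | zero => simpa [digitsOf, binaryDigits, Completes] using h
    | bit b m hb ih =>
      have e : digitsOf true (Nat.bit b m) =
          (if b then InSym.one else InSym.zero) :: digitsOf true m := by
        simp only [digitsOf, binaryDigits, if_true]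
        rw [Nat.bits_append_bit m b hb]
        rfl
      rw [e]
      cases b
      · refine Or.inr ⟨rfl, rfl, ih .zero (Or.inl ?_)⟩
        by_contra h0
        have := hb (by omega)
        simp at this
      · exact Or.inl ⟨rfl, ih .one (by simp)⟩

theorem digitValue_digitsOf (dbl : Bool) (m : ℕ) : digitValue dbl (digitsOf dbl m) = m := by
  cases dbl
  · simp only [digitsOf, unaryDigits, Bool.false_eq_true, if_false]
    induction m with
    | zero => rfl
    | succ m ih => simp [List.replicate_succ, digitValue, ih, numBase, add_comm]
  · simp only [digitsOf, binaryDigits, if_true]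
    induction m using Nat.binaryRec' with
    | zero => simp [digitValue]
    | bit b m hb ih =>
      rw [Nat.bits_append_bit m b hb, List.map_cons, digitValue, ih]
      cases b <;> simp [numBase, Nat.bit_val, add_comm]

/-- The registers after some digits. -/
def afterDigits (dbl : Bool) (f : EncField) (g : Bool) (ds : List InSym) (V : Reg → ℕ) : Reg → ℕ
  | .sum neg after => V (.sum neg after) +
      if (neg == (g ^^ decide (f = .const))) && f.contributes after then
        V .factor * digitValue dbl ds else 0
  | .coeff => V .coeff + if f = .coeff then V .weight * digitValue dbl ds else 0
  | .weight => V .weight * if f = .coeff then numBase dbl ^ ds.length else 1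
  | .factor => V .factor * numBase dbl ^ ds.length

/-- A digit adds the factor, which is then multiplied by the base. This matches the recursion of
`digitValue`, where the first digit is the least significant one. -/
theorem afterDigits_cons (dbl : Bool) (f : EncField) (g : Bool) (a : InSym) (ds : List InSym)
    (V : Reg → ℕ) (x : ℕ) :
    afterDigits dbl f g ds ((digitOp dbl f g (decide (a = .one))).eval V x) =
      afterDigits dbl f g (a :: ds) V := by
  funext r
  rcases r with ⟨neg, after⟩ | _ | _ | _
  · simp only [afterDigits, RegOp.eval, digitOp, Operand.eval, digitValue]
    by_cases h : ((neg == (g ^^ decide (f = .const))) && f.contributes after) = true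
    · by_cases ha : a = .one <;> cases dbl <;>
        simp [h, ha, numBase] <;> ring
    · simp [h, Bool.and_assoc]
  · simp only [afterDigits, RegOp.eval, digitOp, Operand.eval, digitValue]
    by_cases h : f = .coeff
    · by_cases ha : a = .one <;> cases dbl <;> simp [h, ha, numBase] <;> ring
    · simp [h]
  · simp only [afterDigits, RegOp.eval, digitOp, Operand.eval]
    by_cases h : f = .coeff
    · cases dbl <;> simp [h, numBase]
      ring
    · simp [h]
  · simp only [afterDigits, RegOp.eval, digitOp, Operand.eval]
    cases dbl <;> simp [numBase]
    ring

theorem evalWord_digits {dbl : Bool} {f : EncField} {s : NumStatus} {g : Bool} {ds u : List InSym}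
    (h : Completes dbl s ds) (x : ℕ → ℕ) (m : ℕ) (V : Reg → ℕ) :
    evalWord dbl (ds ++ .sep :: u) x (some (f, s, g), m, V) =
      evalWord dbl u (if isGuess (some (f, s, g)) .sep then fun i => x (i + 1) else x)
        (some (f.next, .fresh, g && f.keepsSign),
          if isGuess (some (f, s, g)) .sep then m + 1 else m,
          (sepOp f).eval (afterDigits dbl f g ds V) (x 0)) := by
  induction ds generalizing s V with
  | nil =>
    have e : afterDigits dbl f g [] V = V := by
      funext r
      rcases r with ⟨neg, after⟩ | _ | _ | _ <;> simp [afterDigits, digitValue]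
    have e2 : nextState dbl (some (f, s, g)) .sep = some (f.next, .fresh, g && f.keepsSign) :=
      if_pos h
    rw [e, List.nil_append, evalWord, e2]
    rfl
  | cons a ds ih =>
    have hg : ∀ s', isGuess (some (f, s', g)) .sep = isGuess (some (f, s, g)) .sep := fun s' => by
      cases f <;> rfl
    rcases h with ⟨rfl, h⟩ | ⟨rfl, hd, h⟩
    · have e : isGuess (some (f, s, g)) .one = false := by cases f <;> rfl
      rw [List.cons_append, evalWord]
      simp only [e]
      change evalWord dbl _ x (some (f, .one, g), m, (digitOp dbl f g true).eval V (x 0)) = _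
      rw [ih h, hg, ← afterDigits_cons dbl f g .one ds V (x 0)]
      rfl
    · have e : isGuess (some (f, s, g)) .zero = false := by cases f <;> rfl
      have e2 : nextState dbl (some (f, s, g)) .zero = some (f, .zero, g) := if_pos hd
      rw [List.cons_append, evalWord]
      simp only [e, e2]
      change evalWord dbl _ x (some (f, .zero, g), m, (digitOp dbl f g false).eval V (x 0)) = _
      rw [ih h, hg, ← afterDigits_cons dbl f g .zero ds V (x 0)]
      rfl

theorem evalWord_encodeInteger {dbl : Bool} {f : EncField} (hf : f = .const ∨ f = .coeff) (z : ℤ)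
    (u : List InSym) (x : ℕ → ℕ) (m : ℕ) (V : Reg → ℕ) :
    evalWord dbl (encodeInteger (digitsOf dbl) z ++ u) x (some (f, .fresh, false), m, V) =
      evalWord dbl u (if f = .const then fun i => x (i + 1) else x)
        (some (f.next, .fresh, decide (z < 0) && f.keepsSign), if f = .const then m + 1 else m,
          (sepOp f).eval (afterDigits dbl f (decide (z < 0)) (digitsOf dbl z.natAbs) V) (x 0)) := by
  have hg : ∀ s g, isGuess (some (f, s, g)) .sep = decide (f = .const) := fun s' => by
    rcases hf with rfl | rfl <;> simp [isGuess]
  by_cases hz : z < 0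
  · have e : isGuess (some (f, .fresh, false)) .minus = false := by cases f <;> rfl
    have e2 : nextState dbl (some (f, .fresh, false)) .minus = some (f, .minus, true) :=
      if_pos ⟨rfl, hf⟩
    have e3 : RegOp.eval (letterOp dbl (some (f, .fresh, false)) .minus) V (x 0) = V := by
      funext r
      simp [letterOp, RegOp.eval, keepOp, Operand.eval]
    simp only [encodeInteger, hz, if_true, encodeNatural, List.append_assoc, List.cons_append,
      List.nil_append]
    rw [evalWord]
    simp only [e, e2, e3]
    have := evalWord_digits (f := f) (g := true) (u := u)
      (completes_digitsOf dbl .minus z.natAbs (by omega)) x m V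
    simpa [hg] using this
  · simp only [encodeInteger, hz, if_false, encodeNatural, List.append_assoc, List.cons_append,
      List.nil_append]
    have := evalWord_digits (f := f) (g := false) (u := u)
      (completes_digitsOf dbl .fresh z.natAbs (by simp)) x m V
    simpa [hg] using this

theorem evalWord_encodeNatural {dbl : Bool} {f : EncField} (g : Bool) (k : ℕ)
    (u : List InSym) (x : ℕ → ℕ) (m : ℕ) (V : Reg → ℕ) :
    evalWord dbl (encodeNatural (digitsOf dbl) k ++ u) x (some (f, .fresh, g), m, V) =
      evalWord dbl u (if isGuess (some (f, .fresh, g)) .sep then fun i => x (i + 1) else x)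
        (some (f.next, .fresh, g && f.keepsSign),
          if isGuess (some (f, .fresh, g)) .sep then m + 1 else m,
          (sepOp f).eval (afterDigits dbl f g (digitsOf dbl k) V) (x 0)) := by
  simp only [encodeNatural, List.append_assoc, List.cons_append, List.nil_append]
  exact evalWord_digits (completes_digitsOf dbl .fresh k (by simp)) x m V

/-! ### Evaluation of a whole instance. -/

/-- The encoding of the places of an instance. -/
def encodePlaces (digits : ℕ → List InSym) {n : ℕ} (k : Fin n → ℤ) (p q : Fin n → ℕ) :
    List InSym :=
  (List.ofFn fun i => encodeInteger digits (k i) ++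
    (encodeNatural digits (p i) ++ encodeNatural digits (q i))).flatten

theorem encodePlaces_succ (digits : ℕ → List InSym) {n : ℕ} (k : Fin (n + 1) → ℤ)
    (p q : Fin (n + 1) → ℕ) :
    encodePlaces digits k p q = encodeInteger digits (k 0) ++ (encodeNatural digits (p 0) ++
      (encodeNatural digits (q 0) ++
        encodePlaces digits (fun i => k i.succ) (fun i => p i.succ) (fun i => q i.succ))) := by
  simp [encodePlaces, List.ofFn_succ, List.append_assoc]

/-- While k(i) is read, the factor starts as x(i) and both sums gain k(i)·x(i); meanwhile |k(i)| is
stored in `coeff` and serves as the factor for t⁻(i) and t⁺(i). The multiplicity of the first place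
has been guessed before, hence the special case i = 0. The hypotheses on `coeff` and `weight` are
restored at the end of every place. -/
theorem evalWord_encodePlaces {dbl : Bool} {n : ℕ} (k : Fin n → ℤ) (p q : Fin n → ℕ) (x : ℕ → ℕ)
    (m : ℕ) (V : Reg → ℕ) (hc : V .coeff = 0) (hw : V .weight = 1) :
    ∃ V', evalWord dbl (encodePlaces (digitsOf dbl) k p q) x (finalState, m, V) =
        (finalState, m + n, V') ∧
      ∀ after, excess V' after = excess V after + ∑ i : Fin n,
        k i * ((if (i : ℕ) = 0 then V .factor else x (i - 1)) + if after then q i else p i) := by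
  induction n generalizing x m V with
  | zero => exact ⟨V, rfl, fun after => by simp⟩
  | succ n ih =>
    rw [encodePlaces_succ, finalState, evalWord_encodeInteger (Or.inr rfl)]
    simp only [reduceCtorEq, if_false, EncField.next, EncField.keepsSign, Bool.and_true]
    rw [evalWord_encodeNatural]
    simp only [EncField.next, EncField.keepsSign, Bool.and_true, isGuess, Bool.false_eq_true,
      if_false]
    rw [evalWord_encodeNatural]
    simp only [EncField.next, EncField.keepsSign, Bool.and_false, isGuess, if_true]
    obtain ⟨V', h1, h2⟩ := ih (fun i => k i.succ) (fun i => p i.succ) (fun i => q i.succ)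
      (fun i => x (i + 1)) (m + 1)
      ((sepOp .post).eval (afterDigits dbl .post (decide (k 0 < 0)) (digitsOf dbl (q 0))
        ((sepOp .pre).eval (afterDigits dbl .pre (decide (k 0 < 0)) (digitsOf dbl (p 0))
          ((sepOp .coeff).eval (afterDigits dbl .coeff (decide (k 0 < 0))
            (digitsOf dbl (k 0).natAbs) V) (x 0))) (x 0))) (x 0)) rfl rfl
    refine ⟨V', ?_, ?_⟩
    · rw [← finalState, h1]
      congr 2
      omega
    · intro after
      rw [h2, Fin.sum_univ_succ]
      -- The guess made at the end of t⁺(0) is the factor with which the next place begins.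
      have e : ∀ i : Fin n, (if (i : ℕ) = 0 then
          ((sepOp .post).eval (afterDigits dbl .post (decide (k 0 < 0)) (digitsOf dbl (q 0))
            ((sepOp .pre).eval (afterDigits dbl .pre (decide (k 0 < 0)) (digitsOf dbl (p 0))
            ((sepOp .coeff).eval (afterDigits dbl .coeff (decide (k 0 < 0))
            (digitsOf dbl (k 0).natAbs) V) (x 0))) (x 0))) (x 0)) .factor
          else x (i - 1 + 1)) = x i := by
        intro i
        split_ifs with h
        · simp [h, RegOp.eval, sepOp, Operand.eval]
        · congr 1
          omega
      simp only [e]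
      simp only [excess, RegOp.eval, sepOp, Operand.eval, keepOp, afterDigits,
        digitValue_digitsOf, hc, hw, EncField.contributes]
      by_cases hk : k 0 < 0
      · have : ((k 0).natAbs : ℤ) = - k 0 := by omega
        cases after <;> simp [hk, this] <;> ring
      · have : ((k 0).natAbs : ℤ) = k 0 := by omega
        cases after <;> simp [hk, this] <;> ring

/-- The evaluation of an instance. -/
theorem evalWord_encode {dbl : Bool} {n : ℕ} (I : InductivityInstance n) (x : ℕ → ℕ) :
    ∃ V, evalWord dbl (I.encode (digitsOf dbl)) x startEval = (finalState, n + 1, V) ∧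
      ∀ after, excess V after = - I.c + ∑ i : Fin n,
        I.k i * (x i + if after then I.tPost i else I.tPre i) := by
  change ∃ V, evalWord dbl (encodeInteger _ I.c ++ encodePlaces _ I.k I.tPre I.tPost) x
    (startState, 0, _) = _ ∧ _
  rw [startState, evalWord_encodeInteger (Or.inl rfl)]
  simp only [if_true, EncField.next, EncField.keepsSign, Bool.and_false]
  obtain ⟨V', h1, h2⟩ := evalWord_encodePlaces (dbl := dbl) I.k I.tPre I.tPost
    (fun i => x (i + 1)) (0 + 1) ((sepOp .const).eval (afterDigits dbl .const (decide (I.c < 0))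
      (digitsOf dbl I.c.natAbs) (resetOp.eval (fun _ => 0) 0)) (x 0)) rfl rfl
  -- One guess is made at the end of the constant and one at the end of each place, n + 1 in all;
  -- the last of them is not used.
  refine ⟨V', ?_, fun after => ?_⟩
  · rw [← finalState, h1]
    congr 2
    omega
  · rw [h2]
    congr 1
    · simp only [excess, RegOp.eval, sepOp, Operand.eval, keepOp, afterDigits,
        digitValue_digitsOf, resetOp, EncField.contributes]
      by_cases hk : I.c < 0
      · have : ((I.c).natAbs : ℤ) = - I.c := by omega
        simp [hk, this]
      · have : ((I.c).natAbs : ℤ) = I.c := by omega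
        simp [hk, this]
    · refine Finset.sum_congr rfl fun i _ => ?_
      congr 2
      rcases i with ⟨_ | i, hi⟩ <;> rfl

/-! ### The words that the parser accepts -/

theorem evalWord_fst (dbl : Bool) (u : List InSym) (x : ℕ → ℕ) (s : EvalState) :
    (evalWord dbl u x s).1 = u.foldl (nextState dbl) s.1 := by
  induction u generalizing x s with
  | nil => rfl
  | cons a u ih => rw [evalWord, ih, List.foldl_cons]

theorem foldl_nextState_none (dbl : Bool) (u : List InSym) :
    u.foldl (nextState dbl) none = none := by
  induction u with
  | nil => rfl
  | cons a u ih => rw [List.foldl_cons, nextState, ih]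

/-- The hypothesis `hs` excludes both a minus sign as the next letter and the end of the word, so
digits and an end mark must follow. -/
theorem exists_completes_of_foldl {dbl : Bool} {f : EncField} {s : NumStatus} {g : Bool}
    {u : List InSym} (h : u.foldl (nextState dbl) (some (f, s, g)) = finalState)
    (hs : ¬ (s = .fresh ∧ (f = .const ∨ f = .coeff))) :
    ∃ ds v, u = ds ++ .sep :: v ∧ Completes dbl s ds ∧
      v.foldl (nextState dbl) (some (f.next, .fresh, g && f.keepsSign)) = finalState := by
  induction u generalizing s with
  | nil =>
    simp only [List.foldl_nil, finalState, Option.some.injEq, Prod.mk.injEq] at h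
    exact (hs ⟨h.2.1, Or.inr h.1⟩).elim
  | cons a u ih =>
    rw [List.foldl_cons] at h
    cases a with
    | zero =>
      rw [nextState] at h
      split_ifs at h with hd
      · obtain ⟨ds, v, rfl, h1, h2⟩ := ih h (by simp)
        exact ⟨.zero :: ds, v, rfl, Or.inr ⟨rfl, hd, h1⟩, h2⟩
      · rw [foldl_nextState_none] at h
        cases h
    | one =>
      obtain ⟨ds, v, rfl, h1, h2⟩ := ih h (by simp)
      exact ⟨.one :: ds, v, rfl, Or.inl ⟨rfl, h1⟩, h2⟩
    | minus =>
      rw [nextState, if_neg hs, foldl_nextState_none] at h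
      cases h
    | sep =>
      rw [nextState] at h
      split_ifs at h with hd
      · exact ⟨[], u, rfl, hd, h⟩
      · rw [foldl_nextState_none] at h
        cases h

theorem exists_encodeNatural_of_foldl {dbl : Bool} {f : EncField} {g : Bool} {u : List InSym}
    (h : u.foldl (nextState dbl) (some (f, .fresh, g)) = finalState)
    (hf : ¬ (f = .const ∨ f = .coeff)) :
    ∃ m v, u = encodeNatural (digitsOf dbl) m ++ v ∧
      v.foldl (nextState dbl) (some (f.next, .fresh, g && f.keepsSign)) = finalState := by
  obtain ⟨ds, v, rfl, h1, h2⟩ := exists_completes_of_foldl h (by simp [hf])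
  refine ⟨digitValue dbl ds, v, ?_, h2⟩
  rw [encodeNatural, (digitsOf_digitValue h1).1]
  simp

theorem exists_encodeInteger_of_foldl {dbl : Bool} {f : EncField} {u : List InSym}
    (h : u.foldl (nextState dbl) (some (f, .fresh, false)) = finalState) (hu : u ≠ [])
    (hf : f = .const ∨ f = .coeff) :
    ∃ z v, u = encodeInteger (digitsOf dbl) z ++ v ∧
      v.foldl (nextState dbl) (some (f.next, .fresh, decide (z < 0) && f.keepsSign)) =
        finalState := by
  -- This serves all cases in which the number does not begin with a minus sign.
  have hnat : ∀ ds v, Completes dbl .fresh ds → u = ds ++ .sep :: v →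
      v.foldl (nextState dbl) (some (f.next, .fresh, false && f.keepsSign)) = finalState →
      ∃ z v, u = encodeInteger (digitsOf dbl) z ++ v ∧
      v.foldl (nextState dbl) (some (f.next, .fresh, decide (z < 0) && f.keepsSign)) =
        finalState := by
    intro ds v h1 hu h2
    refine ⟨digitValue dbl ds, v, ?_, ?_⟩
    · have e : ((digitValue dbl ds : ℤ)).natAbs = digitValue dbl ds := by omega
      rw [encodeInteger, if_neg (by omega), encodeNatural, e, (digitsOf_digitValue h1).1, hu]
      simp
    · have e : decide ((digitValue dbl ds : ℤ) < 0) = false := by simp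
      rw [e]
      exact h2
  rcases u with _ | ⟨a, u⟩
  · exact (hu rfl).elim
  rw [List.foldl_cons] at h
  cases a with
  | zero =>
    rw [nextState] at h
    split_ifs at h with hd
    · obtain ⟨ds, v, rfl, h1, h2⟩ := exists_completes_of_foldl h (by simp)
      exact hnat (.zero :: ds) v (Or.inr ⟨rfl, hd, h1⟩) rfl h2
    · rw [foldl_nextState_none] at h
      cases h
  | one =>
    obtain ⟨ds, v, rfl, h1, h2⟩ := exists_completes_of_foldl h (by simp)
    exact hnat (.one :: ds) v (Or.inl ⟨rfl, h1⟩) rfl h2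
  | minus =>
    rw [nextState, if_pos ⟨rfl, hf⟩] at h
    obtain ⟨ds, v, rfl, h1, h2⟩ := exists_completes_of_foldl h (by simp)
    obtain ⟨h3, h4⟩ := digitsOf_digitValue h1
    -- The absolute value is positive, so the minus sign is the one that `encodeInteger` writes;
    -- there is no negative zero.
    have h4 := h4 (Or.inl rfl)
    refine ⟨-(digitValue dbl ds : ℤ), v, ?_, ?_⟩
    · have e : (-(digitValue dbl ds : ℤ)).natAbs = digitValue dbl ds := by omega
      rw [encodeInteger, if_pos (by omega), encodeNatural, e, h3]
      simp
    · have e : decide (-(digitValue dbl ds : ℤ) < 0) = true := by simp [h4]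
      rw [e]
      exact h2
  | sep => exact hnat [] u (Or.inl rfl) rfl h

theorem exists_encodePlaces_of_foldl {dbl : Bool} (l : ℕ) {u : List InSym} (hl : u.length = l)
    (h : u.foldl (nextState dbl) finalState = finalState) :
    ∃ (n : ℕ) (k : Fin n → ℤ) (p q : Fin n → ℕ), u = encodePlaces (digitsOf dbl) k p q := by
  induction l using Nat.strong_induction_on generalizing u with
  | _ l ih =>
    by_cases hu : u = []
    · subst hu
      exact ⟨0, Fin.elim0, Fin.elim0, Fin.elim0, rfl⟩
    · obtain ⟨z, v, rfl, h1⟩ := exists_encodeInteger_of_foldl h hu (Or.inr rfl)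
      obtain ⟨a, v, rfl, h2⟩ := exists_encodeNatural_of_foldl h1 (by simp [EncField.next])
      obtain ⟨b, v, rfl, h3⟩ := exists_encodeNatural_of_foldl h2 (by simp [EncField.next])
      have e : (some (EncField.coeff.next.next.next, .fresh,
          ((decide (z < 0) && EncField.coeff.keepsSign) && EncField.coeff.next.keepsSign) &&
            EncField.coeff.next.next.keepsSign) : ParseState) = finalState := by
        simp [EncField.next, EncField.keepsSign, finalState]
      rw [e] at h3
      obtain ⟨n, k, p, q, rfl⟩ := ih v.length (by
        simp [← hl, encodeInteger, encodeNatural]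
        omega) rfl h3
      refine ⟨n + 1, Fin.cons z k, Fin.cons a p, Fin.cons b q, ?_⟩
      rw [encodePlaces_succ]
      rfl

/-- The parser accepts exactly the encodings of instances. -/
theorem foldl_nextState_eq_finalState {dbl : Bool} {w : List InSym} :
    w.foldl (nextState dbl) startState = finalState ↔
      ∃ (n : ℕ) (I : InductivityInstance n), I.encode (digitsOf dbl) = w := by
  constructor
  · intro h
    have hw : w ≠ [] := by
      rintro rfl
      cases h
    obtain ⟨z, v, rfl, h1⟩ := exists_encodeInteger_of_foldl h hw (Or.inl rfl)
    have e : (some (EncField.const.next, .fresh, decide (z < 0) && EncField.const.keepsSign) :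
        ParseState) = finalState := by
      simp [EncField.next, EncField.keepsSign, finalState]
    rw [e] at h1
    obtain ⟨n, k, p, q, rfl⟩ := exists_encodePlaces_of_foldl _ rfl h1
    exact ⟨n, ⟨k, z, p, q⟩, rfl⟩
  · rintro ⟨n, I, rfl⟩
    obtain ⟨V, h, -⟩ := evalWord_encode (dbl := dbl) I (fun _ => 0)
    have := evalWord_fst dbl (I.encode (digitsOf dbl)) (fun _ => 0) startEval
    rw [h] at this
    exact this.symm

/-! ### Bounds -/

/-- A bound for the numbers with at most `l` digits. -/
def digitBound (dbl : Bool) (l : ℕ) : ℕ := if dbl then 2 ^ l else l + 1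

/-- This recurrence holds for both number systems, so the later estimates can treat them together.
-/
theorem digitBound_succ (dbl : Bool) (l : ℕ) :
    digitBound dbl (l + 1) = digitBound dbl l + numBase dbl ^ l := by
  cases dbl
  · simp [digitBound, numBase]
  · simp [digitBound, numBase, pow_succ]
    ring

theorem digitBound_mono (dbl : Bool) : Monotone (digitBound dbl) :=
  monotone_nat_of_le_succ fun l => by rw [digitBound_succ]; omega

theorem numBase_pow_le (dbl : Bool) (l : ℕ) : numBase dbl ^ l ≤ digitBound dbl l := by
  cases dbl <;> simp [digitBound, numBase]

theorem le_digitBound (dbl : Bool) (l : ℕ) : l + 1 ≤ digitBound dbl l := by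
  cases dbl
  · simp [digitBound]
  · simpa [digitBound] using Nat.lt_two_pow_self

theorem numBase_pos (dbl : Bool) : 0 < numBase dbl := by cases dbl <;> simp [numBase]

theorem digitValue_lt (dbl : Bool) (u : List InSym) :
    digitValue dbl u < digitBound dbl u.length := by
  induction u with
  | nil => cases dbl <;> simp [digitValue, digitBound]
  | cons a u ih =>
    rw [digitValue, List.length_cons]
    cases dbl
    · simp only [numBase, digitBound, Bool.false_eq_true, if_false] at ih ⊢
      split_ifs <;> omega
    · simp only [numBase, digitBound, if_true, pow_succ] at ih ⊢
      split_ifs <;> omega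

theorem lt_digitBound_of_length_le {dbl : Bool} {m l : ℕ} (h : (digitsOf dbl m).length ≤ l) :
    m < digitBound dbl l := by
  have := digitValue_lt dbl (digitsOf dbl m)
  rw [digitValue_digitsOf] at this
  exact this.trans_le (digitBound_mono dbl h)

/-- The registers are bounded, after `l` letters, if the guesses are bounded by `Y`. -/
structure RegBound (dbl : Bool) (Y l : ℕ) (V : Reg → ℕ) : Prop where
  weight : V .weight ≤ numBase dbl ^ l
  coeff : V .coeff ≤ digitBound dbl l
  factor : V .factor ≤ Y * numBase dbl ^ l
  sum : ∀ neg after, V (.sum neg after) ≤ Y * digitBound dbl l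

theorem RegBound.le {dbl : Bool} {Y l : ℕ} {V : Reg → ℕ} (h : RegBound dbl Y l V) (hY : 0 < Y)
    (r : Reg) : V r ≤ Y * digitBound dbl l := by
  rcases r with ⟨neg, after⟩ | _ | _ | _
  · exact h.sum neg after
  · exact h.coeff.trans (Nat.le_mul_of_pos_left _ hY)
  · exact (h.weight.trans (numBase_pow_le dbl l)).trans (Nat.le_mul_of_pos_left _ hY)
  · exact h.factor.trans (Nat.mul_le_mul_left _ (numBase_pow_le dbl l))

theorem RegBound.mono {dbl : Bool} {Y l : ℕ} {V : Reg → ℕ} (h : RegBound dbl Y l V) :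
    RegBound dbl Y (l + 1) V := by
  have h1 : numBase dbl ^ l ≤ numBase dbl ^ (l + 1) :=
    Nat.pow_le_pow_right (numBase_pos dbl) (by omega)
  have h2 := digitBound_mono dbl (Nat.le_succ l)
  exact ⟨h.weight.trans h1, h.coeff.trans h2, h.factor.trans (Nat.mul_le_mul_left _ h1),
    fun neg after => (h.sum neg after).trans (Nat.mul_le_mul_left _ h2)⟩

theorem RegBound.reset (dbl : Bool) {Y : ℕ} (hY : 0 < Y) :
    RegBound dbl Y 0 (resetOp.eval (fun _ => 0) 0) := by
  refine ⟨?_, ?_, ?_, fun neg after => ?_⟩ <;> simp [RegOp.eval, resetOp, Operand.eval]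
  omega

/-- A sum grows by at most the factor, and Y·B(l) + Y·base^l = Y·B(l + 1) for B = `digitBound dbl`.
-/
theorem RegBound.digitOp {dbl : Bool} {Y l : ℕ} {V : Reg → ℕ} (h : RegBound dbl Y l V)
    (f : EncField) (g d : Bool) (x : ℕ) :
    RegBound dbl Y (l + 1) ((digitOp dbl f g d).eval V x) := by
  have h' := h.mono
  have hp : numBase dbl ^ (l + 1) = numBase dbl ^ l + if dbl then numBase dbl ^ l else 0 := by
    cases dbl <;> simp [numBase, pow_succ]
    ring
  refine ⟨?_, ?_, ?_, fun neg after => ?_⟩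
  · simp only [RegOp.eval, _root_.digitOp, Operand.eval, Bool.toNat_false, add_zero]
    rw [hp]
    have := h.weight
    cases dbl
    · simpa [Operand.eval] using this
    · simp only [Bool.true_and, if_true]
      split_ifs <;> simp only <;> omega
  · simp only [RegOp.eval, _root_.digitOp, Operand.eval, Bool.toNat_false, add_zero]
    rw [digitBound_succ]
    have := h.weight
    have := h.coeff
    split_ifs <;> simp only <;> omega
  · simp only [RegOp.eval, _root_.digitOp, Operand.eval, Bool.toNat_false, add_zero]
    rw [hp]
    have := h.factor
    cases dbl
    · simpa [Operand.eval] using this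
    · simp only [if_true, mul_add]
      omega
  · simp only [RegOp.eval, _root_.digitOp, Operand.eval, Bool.toNat_false, add_zero]
    rw [digitBound_succ, mul_add]
    have := h.factor
    have := h.sum neg after
    split_ifs <;> simp only <;> omega

/-- The bounds do not multiply up from place to place, because an end mark replaces the factor by a
guess or a coefficient, and both are at most `Y`. -/
theorem RegBound.letterOp {dbl : Bool} {Y l : ℕ} {V : Reg → ℕ} (h : RegBound dbl Y l V)
    (hY : digitBound dbl l ≤ Y) (s : ParseState) (a : InSym) {x : ℕ} (hx : x ≤ Y) :
    RegBound dbl Y (l + 1) ((letterOp dbl s a).eval V x) := by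
  have hkeep : RegBound dbl Y (l + 1) (keepOp.eval V x) := by
    have : keepOp.eval V x = V := by
      funext r
      simp [RegOp.eval, keepOp, Operand.eval]
    rw [this]
    exact h.mono
  rcases s with _ | ⟨f, s, g⟩
  · exact hkeep
  have h' := h.mono
  have h1 : 0 < numBase dbl ^ (l + 1) := Nat.pow_pos (numBase_pos dbl)
  cases a with
  | zero => exact h.digitOp f g false x
  | one => exact h.digitOp f g true x
  | minus => exact hkeep
  | sep =>
    have hc : V .coeff ≤ Y * numBase dbl ^ (l + 1) :=
      (h.coeff.trans hY).trans (Nat.le_mul_of_pos_right _ h1)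
    have hg : x ≤ Y * numBase dbl ^ (l + 1) := hx.trans (Nat.le_mul_of_pos_right _ h1)
    refine ⟨?_, ?_, ?_, fun neg after => ?_⟩
    · have := h'.weight
      cases f <;> simp [_root_.letterOp, sepOp, RegOp.eval, Operand.eval, keepOp] <;> omega
    · have := h'.coeff
      cases f <;> simp [_root_.letterOp, sepOp, RegOp.eval, Operand.eval, keepOp, this]
    · cases f <;> simpa [_root_.letterOp, sepOp, RegOp.eval, Operand.eval, keepOp]
    · have := h'.sum neg after
      cases f <;> simpa [_root_.letterOp, sepOp, RegOp.eval, Operand.eval, keepOp] using this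

/-! ### Small counterexamples to inductivity -/

/-- A multiplicity vector that shows that the half space is not inductive. -/
def InductivityInstance.Refutes {n : ℕ} (I : InductivityInstance n) (x : Fin n → ℕ) : Prop :=
  I.c ≤ ∑ i, I.k i * (x i + I.tPre i) ∧ ∑ i, I.k i * (x i + I.tPost i) < I.c

theorem InductivityInstance.not_isYes_iff {n : ℕ} (I : InductivityInstance n) :
    ¬ I.IsYes ↔ ∃ x, I.Refutes x := by
  constructor
  · intro h
    simp only [IsYes, PetriNet.IsTInductive, not_forall] at h
    obtain ⟨m, hm, h1, h2⟩ := h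
    have hm' : ∀ i, I.tPre i ≤ m i := hm
    have h1' : I.c ≤ ∑ i, I.k i * (m i : ℤ) := h1
    have h2' : ¬ I.c ≤ ∑ i, I.k i * ((m i : ℤ) + ((I.tPost i : ℤ) - I.tPre i)) := h2
    have e : ∀ i, ((m i - I.tPre i : ℕ) : ℤ) = m i - I.tPre i := fun i => by
      have := hm' i
      omega
    refine ⟨fun i => m i - I.tPre i, ?_, ?_⟩
    · simpa only [e, sub_add_cancel] using h1'
    · rw [not_le] at h2'
      refine lt_of_eq_of_lt (Finset.sum_congr rfl fun i _ => ?_) h2'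
      rw [e]
      ring
  · rintro ⟨x, h1, h2⟩ h
    have h3 : I.c ≤ ∑ i, I.k i * (((x i + I.tPre i : ℕ) : ℤ) + ((I.tPost i : ℤ) - I.tPre i)) :=
      h (fun i => x i + I.tPre i) (fun i => Nat.le_add_left _ _) (by
        change I.c ≤ ∑ i, I.k i * ((x i + I.tPre i : ℕ) : ℤ)
        push_cast
        exact h1)
    refine absurd h3 (not_le.2 (lt_of_eq_of_lt (Finset.sum_congr rfl fun i _ => ?_) h2))
    push_cast
    ring

/-- If an integer combination with natural multiplicities lies in an interval, then this happens
with small multiplicities. -/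
theorem exists_small_combination {n : ℕ} (k : Fin n → ℤ) (a b : ℤ) (K A : ℕ)
    (hk : ∀ i, (k i).natAbs ≤ K) (ha : -(A : ℤ) ≤ a) (hb : b ≤ A)
    (h : ∃ x : Fin n → ℕ, a ≤ ∑ i, k i * x i ∧ ∑ i, k i * x i < b) :
    ∃ x : Fin n → ℕ, (a ≤ ∑ i, k i * x i ∧ ∑ i, k i * x i < b) ∧ ∀ i, x i ≤ n * K ^ 2 + A := by
  classical
  -- The solution is chosen with minimal coordinate sum.
  let p : ℕ → Prop := fun s => ∃ x : Fin n → ℕ,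
    (a ≤ ∑ i, k i * x i ∧ ∑ i, k i * x i < b) ∧ ∑ i, x i = s
  have hp : ∃ s, p s := by
    obtain ⟨x, hx⟩ := h
    exact ⟨_, x, hx, rfl⟩
  obtain ⟨x, hx, hs⟩ := Nat.find_spec hp
  have hmin : ∀ y : Fin n → ℕ, ∑ i, k i * y i = ∑ i, k i * x i → ∑ i, x i ≤ ∑ i, y i := by
    intro y hy
    rw [hs]
    exact Nat.find_min' hp ⟨y, by rwa [hy], rfl⟩
  have hzero : ∀ i, k i = 0 → x i = 0 := by
    intro i hi
    by_contra h0
    have h1 := hmin (Function.update x i 0) ?_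
    · rw [Finset.sum_update_of_mem (Finset.mem_univ i),
        ← Finset.add_sum_erase _ _ (Finset.mem_univ i),
        Finset.sdiff_singleton_eq_erase] at h1
      omega
    · refine Finset.sum_congr rfl fun j _ => ?_
      by_cases hj : j = i
      · subst hj
        simp [hi]
      · rw [Function.update_of_ne hj]
  have hpair : ∀ i j, 0 < k i → k j < 0 → x i < K ∨ x j < K := by
    intro i j hi hj
    by_contra! hc
    have hij : i ≠ j := by
      rintro rfl
      omega
    have hki := hk i
    have hkj := hk j
    -- The exchange: the changes of `k · x` at `i` and at `j` cancel, while the coordinate sum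
    -- drops.
    let y : Fin n → ℕ := fun l =>
      x l - ((if l = i then (k j).natAbs else 0) + if l = j then (k i).natAbs else 0)
    have hy : ∀ l, (x l : ℤ) = y l +
        ((if l = i then ((k j).natAbs : ℤ) else 0) + if l = j then ((k i).natAbs : ℤ) else 0) := by
      intro l
      by_cases h1 : l = i
      · subst h1
        simp only [y, if_true, if_neg hij]
        omega
      · by_cases h2 : l = j
        · subst h2
          simp only [y, if_true, if_neg h1]
          omega
        · simp [y, h1, h2]
    have h1 := hmin y ?_
    · have h2 : (∑ l, (x l : ℤ)) ≤ ∑ l, (y l : ℤ) := by exact_mod_cast h1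
      simp only [hy, Finset.sum_add_distrib, Finset.sum_ite_eq', Finset.mem_univ, if_true] at h2
      omega
    · simp only [hy, mul_add, Finset.sum_add_distrib, mul_ite, mul_zero, Finset.sum_ite_eq',
        Finset.mem_univ, if_true]
      rw [Int.natCast_natAbs, Int.natCast_natAbs, abs_of_pos hi, abs_of_neg hj]
      ring
  -- Otherwise a large coordinate of each sign would contradict `hpair`.
  have hcase : (∀ i, 0 < k i → x i ≤ K) ∨ (∀ i, k i < 0 → x i ≤ K) := by
    by_contra! hc
    obtain ⟨⟨i, hi, hi'⟩, j, hj, hj'⟩ := hc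
    rcases hpair i j hi hj with h1 | h1 <;> omega
  have hsplit : ∀ i, (∀ j, j ≠ i → k j * x j ≤ (K : ℤ) ^ 2) →
      ∑ j, k j * x j ≤ k i * x i + n * (K : ℤ) ^ 2 := by
    intro i hi
    rw [← Finset.add_sum_erase _ _ (Finset.mem_univ i)]
    have h1 := Finset.sum_le_card_nsmul (Finset.univ.erase i) (fun j => k j * (x j : ℤ)) _
      (fun j hj => hi j (Finset.ne_of_mem_erase hj))
    have h2 : ((Finset.univ.erase i).card : ℤ) ≤ n := by
      have := Finset.card_le_univ (Finset.univ.erase i)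
      simp only [Fintype.card_fin] at this
      exact_mod_cast this
    rw [nsmul_eq_mul] at h1
    have h3 := mul_le_mul_of_nonneg_right h2 (sq_nonneg (K : ℤ))
    linarith
  have hsplit' : ∀ i, (∀ j, j ≠ i → -(K : ℤ) ^ 2 ≤ k j * x j) →
      k i * x i - n * (K : ℤ) ^ 2 ≤ ∑ j, k j * x j := by
    intro i hi
    rw [← Finset.add_sum_erase _ _ (Finset.mem_univ i)]
    have h1 := Finset.card_nsmul_le_sum (Finset.univ.erase i) (fun j => k j * (x j : ℤ)) _
      (fun j hj => hi j (Finset.ne_of_mem_erase hj))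
    have h2 : ((Finset.univ.erase i).card : ℤ) ≤ n := by
      have := Finset.card_le_univ (Finset.univ.erase i)
      simp only [Fintype.card_fin] at this
      exact_mod_cast this
    rw [nsmul_eq_mul] at h1
    have h3 := mul_le_mul_of_nonneg_right h2 (sq_nonneg (K : ℤ))
    linarith
  -- The index `i` serves only to guarantee n ≥ 1.
  have hn : ∀ i : Fin n, (K : ℤ) ≤ n * (K : ℤ) ^ 2 := by
    intro i
    have : 1 ≤ (n : ℤ) := by have := i.2; omega
    nlinarith [sq_nonneg (K : ℤ), Int.le_self_sq (K : ℤ)]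
  refine ⟨x, hx, fun i => ?_⟩
  zify
  rcases lt_trichotomy (k i) 0 with hi | hi | hi
  · rcases hcase with hc | hc
    -- The other terms contribute at most K² each, so k·x ≥ a ≥ −A forces x(i) ≤ nK² + A. The case
    -- k(i) > 0 is symmetric and uses the upper end of the interval.
    · have h1 := hsplit i (fun j _ => by
        have h2 := hk j
        rcases le_or_gt (k j) 0 with h3 | h3
        · nlinarith [sq_nonneg (K : ℤ), Int.natCast_nonneg (x j)]
        · have h4 := hc j h3
          have h5 : k j ≤ K := by omega
          have h6 : (x j : ℤ) ≤ K := by omega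
          nlinarith [Int.natCast_nonneg (x j)])
      have h2 : k i * (x i : ℤ) ≤ -(x i : ℤ) := by nlinarith [Int.natCast_nonneg (x i)]
      linarith [hx.1]
    · have h1 := hc i hi
      have := hn i
      have : (x i : ℤ) ≤ K := by omega
      linarith [Int.natCast_nonneg A]
  · rw [hzero i hi]
    positivity
  · rcases hcase with hc | hc
    · have h1 := hc i hi
      have := hn i
      have : (x i : ℤ) ≤ K := by omega
      linarith [Int.natCast_nonneg A]
    · have h1 := hsplit' i (fun j _ => by
        have h2 := hk j
        rcases le_or_gt 0 (k j) with h3 | h3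
        · nlinarith [sq_nonneg (K : ℤ), Int.natCast_nonneg (x j)]
        · have h4 := hc j h3
          have h5 : -(K : ℤ) ≤ k j := by omega
          have h6 : (x j : ℤ) ≤ K := by omega
          nlinarith [Int.natCast_nonneg (x j)])
      have h2 : (x i : ℤ) ≤ k i * (x i : ℤ) := by nlinarith [Int.natCast_nonneg (x i)]
      linarith [hx.2]

/-- The numbers n, |c|, |k(i)|, t⁻(i) and t⁺(i) are all at most L, so |k·t⁻| and |k·t⁺| are at most
L³. The relevant ends of the interval for k·x are thus bounded by L + L³ ≤ 2L³, and
`exists_small_combination` gives nL² + 2L³ ≤ 3L³. -/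
theorem InductivityInstance.exists_small_refutes {dbl : Bool} {n : ℕ} (I : InductivityInstance n)
    (h : ∃ x, I.Refutes x) {L : ℕ} (hL : L = digitBound dbl (I.encode (digitsOf dbl)).length) :
    ∃ x, I.Refutes x ∧ ∀ i, x i ≤ 3 * L ^ 3 := by
  have hc : I.c.natAbs ≤ L := by
    rw [hL]
    refine (lt_digitBound_of_length_le ?_).le
    simp [encode, encodeInteger, encodeNatural]
    omega
  have hlen : (I.encode (digitsOf dbl)).length = (encodeInteger (digitsOf dbl) I.c).length +
      ∑ i, (encodeInteger (digitsOf dbl) (I.k i) ++ (encodeNatural (digitsOf dbl)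
        (I.tPre i) ++ encodeNatural (digitsOf dbl) (I.tPost i))).length := by
    unfold encode
    rw [List.length_append, List.length_flatten, List.map_ofFn, List.sum_ofFn]
    rfl
  have hplace : ∀ i, (encodeInteger (digitsOf dbl) (I.k i) ++ (encodeNatural (digitsOf dbl)
      (I.tPre i) ++ encodeNatural (digitsOf dbl) (I.tPost i))).length ≤
        (I.encode (digitsOf dbl)).length := by
    intro i
    rw [hlen]
    exact (Finset.single_le_sum (f := fun i => (encodeInteger (digitsOf dbl) (I.k i) ++
      (encodeNatural (digitsOf dbl) (I.tPre i) ++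
        encodeNatural (digitsOf dbl) (I.tPost i))).length) (fun _ _ => Nat.zero_le _)
      (Finset.mem_univ i)).trans (Nat.le_add_left _ _)
  have hk : ∀ i, (I.k i).natAbs ≤ L := by
    intro i
    rw [hL]
    refine (lt_digitBound_of_length_le (le_trans ?_ (hplace i))).le
    simp [encodeInteger, encodeNatural]
    omega
  have hpre : ∀ i, I.tPre i ≤ L := by
    intro i
    rw [hL]
    refine (lt_digitBound_of_length_le (le_trans ?_ (hplace i))).le
    simp [encodeInteger, encodeNatural]
    omega
  have hpost : ∀ i, I.tPost i ≤ L := by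
    intro i
    rw [hL]
    refine (lt_digitBound_of_length_le (le_trans ?_ (hplace i))).le
    simp [encodeInteger, encodeNatural]
    omega
  have hn : n ≤ L := by
    rw [hL]
    refine le_trans ?_ ((Nat.le_succ _).trans (le_digitBound dbl _))
    rw [hlen]
    calc n = ∑ _i : Fin n, 1 := by simp
      _ ≤ _ := (Finset.sum_le_sum fun i _ => by
          simp [encodeInteger, encodeNatural]; omega).trans (Nat.le_add_left _ _)
  have hL1 : 1 ≤ L := by
    rw [hL]
    exact le_trans (by omega) (le_digitBound dbl _)
  have hdot : ∀ t : Fin n → ℕ, (∀ i, t i ≤ L) → |∑ i, I.k i * (t i : ℤ)| ≤ (L : ℤ) ^ 3 := by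
    intro t ht
    refine (Finset.abs_sum_le_sum_abs _ _).trans ?_
    refine (Finset.sum_le_card_nsmul _ _ ((L : ℤ) ^ 2) fun i _ => ?_).trans ?_
    · rw [abs_mul, sq]
      have h1 : |I.k i| ≤ L := by rw [Int.abs_eq_natAbs]; exact_mod_cast hk i
      have h2 : |(t i : ℤ)| ≤ L := by rw [Nat.abs_cast]; exact_mod_cast ht i
      exact mul_le_mul h1 h2 (abs_nonneg _) (by positivity)
    · rw [Finset.card_univ, Fintype.card_fin, nsmul_eq_mul]
      have : (n : ℤ) ≤ L := by exact_mod_cast hn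
      nlinarith [sq_nonneg (L : ℤ)]
  have hp := abs_le.1 (hdot _ hpre)
  have hq := abs_le.1 (hdot _ hpost)
  have hL3 : (L : ℤ) ≤ (L : ℤ) ^ 3 := by
    exact_mod_cast Nat.le_self_pow (by norm_num) L
  have hcc : -(L : ℤ) ≤ I.c ∧ I.c ≤ L := by omega
  have href : ∀ x : Fin n → ℕ, I.Refutes x ↔
      I.c - ∑ i, I.k i * (I.tPre i : ℤ) ≤ ∑ i, I.k i * (x i : ℤ) ∧
        ∑ i, I.k i * (x i : ℤ) < I.c - ∑ i, I.k i * (I.tPost i : ℤ) := by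
    intro x
    simp only [Refutes, mul_add, Finset.sum_add_distrib]
    constructor <;> rintro ⟨h1, h2⟩ <;> constructor <;> linarith
  simp only [href] at h ⊢
  obtain ⟨x, hx, hb⟩ := exists_small_combination I.k _ _ L (2 * L ^ 3) hk
    (by push_cast; linarith [hp.2]) (by push_cast; linarith [hq.1]) h
  refine ⟨x, hx, fun i => (hb i).trans ?_⟩
  have := Nat.mul_le_mul_right (L ^ 2) hn
  calc n * L ^ 2 + 2 * L ^ 3 ≤ L * L ^ 2 + 2 * L ^ 3 := by omega
    _ = 3 * L ^ 3 := by ring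

/-! ### The machine -/

/-- The base in which the registers are kept. -/
def radix : ℕ := 64

instance : NeZero radix := ⟨by decide⟩

theorem one_lt_radix : 1 < radix := by decide

/-- How the multiplicities are guessed: by reading them off some additional tracks of the tape, or
by choosing their digits. If `exact` holds, the number of places has to be the number of tracks. -/
structure GuessMode where
  tracks : ℕ
  Ch : Type
  nonempty_Ch : Nonempty Ch
  digit : Fin (tracks + 3) → Ch → (Fin tracks → Fin radix) → Fin radix
  exact : Bool

/-- The multiplicities are chosen. -/
def choiceMode : GuessMode where
  tracks := 0
  Ch := Fin radix
  nonempty_Ch := ⟨0⟩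
  digit _ c _ := c
  exact := false

/-- The multiplicities are read off `n` tracks. -/
def trackMode (n : ℕ) : GuessMode where
  tracks := n
  Ch := Unit
  nonempty_Ch := ⟨()⟩
  digit i _ t := if h : (i : ℕ) < n then t ⟨i, h⟩ else 0
  exact := true

/-- A column of the tape: a digit of each register and of each track. -/
abbrev Column (n : ℕ) := (Reg → Fin radix) × (Fin n → Fin radix)

/-- The state of a scan: the state of the parser, the number of guesses (up to `n + 2`), whether an
overflow occurred, and whether the registers refute inductivity. -/
abbrev ScanState (n : ℕ) := ParseState × Fin (n + 3) × Bool × Bool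

/-- The states of the machine between sweeps. -/
inductive Control (n : ℕ) where
  | size
  | rewind
  | scan (s : ScanState n)
  | exhausted

/-- The states of the machine during a sweep. -/
inductive Sweep (n : ℕ) where
  | size (carry : Bool)
  | keep
  | arith (op : RegOp) (i : Fin (n + 3)) (carry : Reg → Bool) (cmp : Bool → Bool) (s : ParseState)
      (m : Fin (n + 3)) (ovf : Bool)
  | odo (carry : Bool)

instance (n : ℕ) : Finite (Control n) :=
  Finite.of_injective
    (fun p : Control n => match p with
      | .size => (Sum.inl 0 : Fin 3 ⊕ ScanState n)
      | .rewind => Sum.inl 1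
      | .exhausted => Sum.inl 2
      | .scan s => Sum.inr s)
    (by rintro (_ | _ | _ | _) (_ | _ | _ | _) h <;> simp_all)

instance (n : ℕ) : Finite (Sweep n) :=
  Finite.of_injective
    (fun p : Sweep n => match p with
      | .keep => (Sum.inl none : Option (Bool × Bool) ⊕ (RegOp × Fin (n + 3) × (Reg → Bool) ×
          (Bool → Bool) × ParseState × Fin (n + 3) × Bool))
      | .size c => Sum.inl (some (false, c))
      | .odo c => Sum.inl (some (true, c))
      | .arith op i carry cmp s m ovf => Sum.inr (op, i, carry, cmp, s, m, ovf))
    (by rintro (_ | _ | _ | _) (_ | _ | _ | _) h <;> simp_all)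

/-- The number of contents of the tracks in a column. -/
def trackCard (n : ℕ) : ℕ := Fintype.card (Fin n → Fin radix)

theorem trackCard_pos (n : ℕ) : 0 < trackCard n := Fintype.card_pos

/-- The contents of the tracks in a column, as digits. -/
noncomputable def trackEquiv (n : ℕ) : (Fin n → Fin radix) ≃ Fin (trackCard n) :=
  Fintype.equivFin _

/-- The order in which `trackEquiv` enumerates the contents is irrelevant: it is only used for
counting through all of them. -/
noncomputable def zeroTracks (n : ℕ) : Fin n → Fin radix :=
  (trackEquiv n).symm ⟨0, trackCard_pos n⟩

noncomputable def nextTracks {n : ℕ} (t : Fin n → Fin radix) : Fin n → Fin radix :=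
  (trackEquiv n).symm ⟨(trackEquiv n t + 1) % trackCard n, Nat.mod_lt _ (trackCard_pos n)⟩

/-- An instance with n places makes n + 1 guesses; the extra value n + 2 stands for any larger
number. -/
def bumpCount {n : ℕ} (m : Fin (n + 3)) : Fin (n + 3) := ⟨min (m + 1) (n + 2), by omega⟩

/-- The bit of the length counter in a column. -/
def sizeBit {n : ℕ} (c : Column n) : ℕ := if c.1 .factor = 0 then 0 else 1

/-! ### The transducer and the control of the machine. -/

namespace GuessMode

variable (G : GuessMode)

def operandDigit (i : Fin (G.tracks + 3)) (x : G.Ch × Column G.tracks) : Operand → ℕ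
  | .zero => 0
  | .guess => G.digit i x.1 x.2.2
  | .reg r => x.2.1 r

def total (op : RegOp) (i : Fin (G.tracks + 3)) (carry : Reg → Bool)
    (x : G.Ch × Column G.tracks) (r : Reg) : ℕ :=
  G.operandDigit i x (op r).1 + G.operandDigit i x (op r).2.1 + (carry r).toNat

/-- The transducer. -/
noncomputable def pass (dbl : Bool) :
    Sweep G.tracks → G.Ch → Column G.tracks → Sweep G.tracks × Column G.tracks
  | .size carry, _, c =>
    -- For binary input the carry persists and each round appends a column. For unary input the
    -- columns form a binary counter, whose bits are kept in the registers.
    if dbl || !carry then (.size carry, c)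
    else (.size (decide (c.1 .factor ≠ 0)),
      (fun _ => if c.1 .factor = 0 then Fin.ofNat radix 1 else 0, c.2))
  | .keep, _, c => (.keep, c)
  | .arith op i carry cmp s m ovf, ch, c =>
    (.arith op i (fun r => decide (radix ≤ G.total op i carry (ch, c) r))
      -- The digits come least significant first, so the comparison at the present digit overrules
      -- the earlier one unless the digits agree.
      (fun after =>
        decide (G.total op i carry (ch, c) (.sum true after) % radix <
          G.total op i carry (ch, c) (.sum false after) % radix) ||
        (decide (G.total op i carry (ch, c) (.sum true after) % radix =
          G.total op i carry (ch, c) (.sum false after) % radix) && cmp after)) s m ovf,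
      (fun r => Fin.ofNat radix (G.total op i carry (ch, c) r), c.2))
  | .odo carry, _, c =>
    if carry then (.odo (decide ((trackEquiv G.tracks c.2 : ℕ) + 1 = trackCard G.tracks)),
      (c.1, nextTracks c.2))
    else (.odo false, c)

/-- The parser rejects, or the number of places is wrong. -/
def bad (s : ScanState G.tracks) : Bool :=
  decide (s.1 ≠ finalState) || (G.exact && decide ((s.2.1 : ℕ) ≠ G.tracks + 1))

/-- The word is no encoding or encodes an instance that is not inductive. -/
def stops (s : ScanState G.tracks) : Bool := G.bad s || (!s.2.2.1 && s.2.2.2)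

/-- The bit of a register update enters as the initial carry. The comparison starts with `true`
since it tests `≤`. -/
def sweepOf (op : RegOp) (i : Fin (G.tracks + 3)) (s : ParseState) (m : Fin (G.tracks + 3))
    (ovf : Bool) : Sweep G.tracks :=
  .arith op i (fun r => (op r).2.2) (fun _ => true) s m ovf

def letterSweep (dbl : Bool) (s : ScanState G.tracks) (a : InSym) : Sweep G.tracks :=
  G.sweepOf (letterOp dbl s.1 a) s.2.1 (nextState dbl s.1 a)
    (if isGuess s.1 a then bumpCount s.2.1 else s.2.1) s.2.2.1

def resetSweep : Sweep G.tracks := G.sweepOf resetOp 0 startState 0 false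

/-- A scan that arrives at the right end either halts, which shows that the input is not in the
language, or advances the counter on the tracks. Without tracks this counter has a single value and
overflows at once, so every computation scans the input just once. -/
def launch (dbl : Bool) : Control G.tracks → InputCell InSym → Option (Sweep G.tracks × HeadMove)
  | .size, .rightEnd => some (.keep, .left)
  | .size, _ => some (.size true, .right)
  | .rewind, .leftEnd => some (G.resetSweep, .right)
  | .rewind, _ => some (.keep, .left)
  | .scan s, .letter a => some (G.letterSweep dbl s a, .right)
  | .scan s, .rightEnd => if G.stops s then none else some (.odo true, .stay)
  | .scan _, .leftEnd => none
  | .exhausted, _ => none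

def finish : Sweep G.tracks → Control G.tracks
  | .size _ => .size
  | .keep => .rewind
  | .arith _ _ carry cmp s m ovf =>
    -- A carry out of the last column is an overflow. The last component says that the excess is
    -- nonnegative before firing and negative afterwards.
    .scan (s, m, ovf || decide (∃ r, carry r = true), cmp false && !cmp true)
  | .odo carry => if carry then .exhausted else .rewind

/-- The digit 1 of the new column is the carry out of the length counter. -/
noncomputable def extend : Sweep G.tracks → Option (Column G.tracks)
  | .size true => some (fun _ => Fin.ofNat radix 1, zeroTracks G.tracks)
  | _ => none

/-- The machine for inductivity: it marks off some space, depending on the length of the input, and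
evaluates the input for each content of the tracks. -/
noncomputable def machine (dbl : Bool) (accept : Set (Control G.tracks)) : PassMachine InSym where
  Q := Control G.tracks
  Col := Column G.tracks
  S := Sweep G.tracks
  Ch := G.Ch
  finite_Q := inferInstance
  finite_Col := inferInstance
  finite_S := inferInstance
  nonempty_Ch := G.nonempty_Ch
  start := .size
  accept := accept
  launch := G.launch dbl
  pass := G.pass dbl
  extend := G.extend
  finish := G.finish

end GuessMode

/-! ### The effect of a sweep -/

/-- The number that is written in some component of the columns. -/
def regVal {n : ℕ} (cols : List (Column n)) (r : Reg) : ℕ :=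
  Nat.ofDigits radix (cols.map fun c => (c.1 r : ℕ))

/-- The contents of the tracks as a number. -/
noncomputable def trackNum {n : ℕ} (t : List (Fin n → Fin radix)) : ℕ :=
  Nat.ofDigits (trackCard n) (t.map fun c => (trackEquiv n c : ℕ))

theorem ofDigits_map_lt {A : Type*} {b : ℕ} (f : A → Fin b) (l : List A) :
    Nat.ofDigits b (l.map fun c => (f c : ℕ)) < b ^ l.length := by
  induction l with
  | nil => simp
  | cons c l ih =>
    simp only [List.map_cons, Nat.ofDigits_cons, List.length_cons, pow_succ]
    have := (f c).2
    calc (f c : ℕ) + b * Nat.ofDigits b (l.map fun c => (f c : ℕ))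
        < b + b * Nat.ofDigits b (l.map fun c => (f c : ℕ)) := by omega
      _ = b * (Nat.ofDigits b (l.map fun c => (f c : ℕ)) + 1) := by ring
      _ ≤ b * b ^ l.length := Nat.mul_le_mul_left _ ih
      _ = b ^ l.length * b := by ring

theorem exists_ofDigits_map {A : Type*} {b : ℕ} (f : A → Fin b) (hf : Function.Surjective f)
    (W x : ℕ) (hx : x < b ^ W) :
    ∃ l : List A, l.length = W ∧ Nat.ofDigits b (l.map fun c => (f c : ℕ)) = x := by
  induction W generalizing x with
  | zero => exact ⟨[], rfl, by simp at hx ⊢; omega⟩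
  | succ W ih =>
    have hb : 0 < b := by
      by_contra h
      simp [Nat.eq_zero_of_not_pos h] at hx
    obtain ⟨l, hl, h⟩ := ih (x / b) (Nat.div_lt_of_lt_mul (by rwa [pow_succ, mul_comm] at hx))
    obtain ⟨a, ha⟩ := hf ⟨x % b, Nat.mod_lt _ hb⟩
    refine ⟨a :: l, by simp [hl], ?_⟩
    rw [List.map_cons, Nat.ofDigits_cons, h, ha]
    exact Nat.mod_add_div x b

theorem trackNum_injective {n : ℕ} {t t' : List (Fin n → Fin radix)} (hl : t.length = t'.length)
    (h : trackNum t = trackNum t') : t = t' := by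
  induction t generalizing t' with
  | nil => exact (List.length_eq_zero_iff.1 hl.symm).symm
  | cons c t ih =>
    rcases t' with _ | ⟨c', t'⟩
    · simp at hl
    · simp only [trackNum, List.map_cons, Nat.ofDigits_cons] at h
      have h1 := congrArg (· % trackCard n) h
      simp only [Nat.add_mul_mod_self_left, Nat.mod_eq_of_lt (Fin.is_lt _)] at h1
      rw [h1] at h
      have h2 := Nat.eq_of_mul_eq_mul_left (trackCard_pos n) (Nat.add_left_cancel h)
      rw [ih (by simpa using hl) h2, (trackEquiv n).injective (Fin.ext h1)]

theorem ofDigits_map_zero {A : Type*} (b : ℕ) (l : List A) :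
    Nat.ofDigits b (l.map fun _ => 0) = 0 := by
  induction l with
  | nil => simp
  | cons c l ih => rw [List.map_cons, Nat.ofDigits_cons, ih]; simp

namespace GuessMode

variable (G : GuessMode) (dbl : Bool)

/-- The multiplicity that is guessed in a sweep. -/
def guessVal (i : Fin (G.tracks + 3)) (l : List (G.Ch × Column G.tracks)) : ℕ :=
  Nat.ofDigits radix (l.map fun x => (G.digit i x.1 x.2.2 : ℕ))

theorem ofDigits_operandDigit (i : Fin (G.tracks + 3)) (l : List (G.Ch × Column G.tracks))
    (o : Operand) : Nat.ofDigits radix (l.map fun x => G.operandDigit i x o) =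
      o.eval (regVal (l.map Prod.snd)) (G.guessVal i l) := by
  cases o with
  | zero => exact ofDigits_map_zero _ _
  | guess => rfl
  | reg r =>
    simp only [Operand.eval, regVal, List.map_map]
    rfl

theorem run_keep (l : List (G.Ch × Column G.tracks)) :
    runPass (G.pass dbl) Sweep.keep l = (Sweep.keep, l.map Prod.snd) := by
  induction l with
  | nil => rfl
  | cons x l ih =>
    rw [runPass]
    change ((runPass (G.pass dbl) Sweep.keep l).1,
      x.2 :: (runPass (G.pass dbl) Sweep.keep l).2) = _
    rw [ih]
    rfl

theorem run_size_true (l : List (G.Ch × Column G.tracks)) (carry : Bool) :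
    runPass (G.pass true) (Sweep.size carry) l = (Sweep.size carry, l.map Prod.snd) := by
  induction l with
  | nil => rfl
  | cons x l ih =>
    rw [runPass]
    change ((runPass (G.pass true) (Sweep.size carry) l).1,
      x.2 :: (runPass (G.pass true) (Sweep.size carry) l).2) = _
    rw [ih]
    rfl

/-- This is the increment of a binary counter. The quantifier over `l'` expresses that the result
does not depend on the choices. -/
theorem run_size_false (carry : Bool) (l : List (G.Ch × Column G.tracks)) :
    ∃ carry' cols, (∀ l' : List (G.Ch × Column G.tracks), l'.map Prod.snd = l.map Prod.snd →
        runPass (G.pass false) (Sweep.size carry) l' = (Sweep.size carry', cols)) ∧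
      cols.length = l.length ∧ cols.map Prod.snd = (l.map Prod.snd).map Prod.snd ∧
      Nat.ofDigits 2 (cols.map sizeBit) + 2 ^ l.length * carry'.toNat =
        Nat.ofDigits 2 ((l.map Prod.snd).map sizeBit) + carry.toNat := by
  induction l generalizing carry with
  | nil =>
    refine ⟨carry, [], ?_, rfl, rfl, by simp⟩
    intro l' hl'
    rw [List.map_nil, List.map_eq_nil_iff] at hl'
    subst hl'
    rfl
  | cons x l ih =>
    obtain ⟨c1, cols, h1, h2, h3, h4⟩ := ih (carry && decide (x.2.1 .factor ≠ 0))
    refine ⟨c1, (if carry then (fun _ => if x.2.1 .factor = 0 then Fin.ofNat radix 1 else 0, x.2.2)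
      else x.2) :: cols, ?_, by simp [h2], ?_, ?_⟩
    · intro l' hl'
      rcases l' with _ | ⟨y, l'⟩
      · simp at hl'
      · simp only [List.map_cons, List.cons.injEq] at hl'
        rw [runPass]
        have h5 := h1 l' hl'.2
        cases carry
        · simp only [pass, Bool.false_or, Bool.not_false, if_true, hl'.1]
          simp only [Bool.false_and] at h5
          rw [h5]
          rfl
        · simp only [pass, Bool.false_or, Bool.not_true, Bool.false_eq_true, if_false, if_true,
            hl'.1]
          simp only [Bool.true_and] at h5
          rw [h5]
    · rw [List.map_cons, h3]
      cases carry <;> rfl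
    · simp only [List.map_cons, Nat.ofDigits_cons, List.length_cons, pow_succ]
      have hone : radix ≠ 1 := one_lt_radix.ne'
      cases carry
      · simp only [Bool.false_and, Bool.toNat_false, Bool.false_eq_true, if_false] at h4 ⊢
        linarith
      · simp only [Bool.true_and, if_true, Bool.toNat_true] at h4 ⊢
        by_cases h0 : x.2.1 .factor = 0
        · simp [sizeBit, h0, hone] at h4 ⊢
          linarith
        · simp [sizeBit, h0] at h4 ⊢
          linarith

theorem run_odo (carry : Bool) (l : List (G.Ch × Column G.tracks)) :
    ∃ carry' cols, (∀ l' : List (G.Ch × Column G.tracks), l'.map Prod.snd = l.map Prod.snd →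
        runPass (G.pass dbl) (Sweep.odo carry) l' = (Sweep.odo carry', cols)) ∧
      cols.length = l.length ∧
      trackNum (cols.map Prod.snd) + trackCard G.tracks ^ l.length * carry'.toNat =
        trackNum ((l.map Prod.snd).map Prod.snd) + carry.toNat := by
  induction l generalizing carry with
  | nil =>
    refine ⟨carry, [], ?_, rfl, by simp [trackNum]⟩
    intro l' hl'
    rw [List.map_nil, List.map_eq_nil_iff] at hl'
    subst hl'
    rfl
  | cons x l ih =>
    obtain ⟨c1, cols, h1, h2, h4⟩ :=
      ih (carry && decide ((trackEquiv G.tracks x.2.2 : ℕ) + 1 = trackCard G.tracks))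
    refine ⟨c1, (if carry then (x.2.1, nextTracks x.2.2) else x.2) :: cols, ?_, by simp [h2], ?_⟩
    · intro l' hl'
      rcases l' with _ | ⟨y, l'⟩
      · simp at hl'
      · simp only [List.map_cons, List.cons.injEq] at hl'
        rw [runPass]
        have h5 := h1 l' hl'.2
        cases carry
        · simp only [pass, Bool.false_eq_true, if_false, hl'.1]
          simp only [Bool.false_and] at h5
          rw [h5]
        · simp only [pass, if_true, hl'.1]
          simp only [Bool.true_and] at h5
          rw [h5]
    · simp only [trackNum, List.map_cons, Nat.ofDigits_cons, List.length_cons, pow_succ] at h4 ⊢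
      cases carry
      · simp only [Bool.false_and, Bool.toNat_false, Bool.false_eq_true, if_false] at h4 ⊢
        rw [add_zero] at h4 ⊢
        rw [← h4]
        ring
      · simp only [Bool.true_and, if_true, Bool.toNat_true] at h4 ⊢
        have hlt := (trackEquiv G.tracks x.2.2).2
        by_cases h0 : (trackEquiv G.tracks x.2.2 : ℕ) + 1 = trackCard G.tracks
        · have e : ((trackEquiv G.tracks (nextTracks x.2.2) : Fin _) : ℕ) = 0 := by
            simp [nextTracks, h0]
          simp only [h0, decide_true, Bool.toNat_true] at h4
          rw [e, zero_add]
          calc _ = trackCard G.tracks * (Nat.ofDigits (trackCard G.tracks)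
                ((cols.map Prod.snd).map fun c => (trackEquiv G.tracks c : ℕ)) +
                trackCard G.tracks ^ l.length * c1.toNat) := by ring
            _ = _ := by rw [h4, mul_add, mul_one]; omega
        · have e : ((trackEquiv G.tracks (nextTracks x.2.2) : Fin _) : ℕ) =
              trackEquiv G.tracks x.2.2 + 1 := by
            simp only [nextTracks, Equiv.apply_symm_apply]
            exact Nat.mod_eq_of_lt (by omega)
          simp only [h0, decide_false, Bool.toNat_false, add_zero] at h4
          rw [e, ← h4]
          ring

/-- Addition with carries, done for all registers at once and together with a comparison of the
resulting sums; arbitrary initial carries and comparisons are needed for the induction. -/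
theorem run_arith (op : RegOp) (i : Fin (G.tracks + 3)) (carry : Reg → Bool) (cmp : Bool → Bool)
    (s : ParseState) (m : Fin (G.tracks + 3)) (ovf : Bool) (l : List (G.Ch × Column G.tracks)) :
    ∃ carry' cmp' cols, runPass (G.pass dbl) (Sweep.arith op i carry cmp s m ovf) l =
        (Sweep.arith op i carry' cmp' s m ovf, cols) ∧
      cols.length = l.length ∧ cols.map Prod.snd = (l.map Prod.snd).map Prod.snd ∧
      (∀ r, regVal cols r + radix ^ l.length * (carry' r).toNat =
        Nat.ofDigits radix (l.map fun x => G.operandDigit i x (op r).1) +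
        Nat.ofDigits radix (l.map fun x => G.operandDigit i x (op r).2.1) + (carry r).toNat) ∧
      ∀ after, cmp' after = true ↔ regVal cols (.sum true after) < regVal cols (.sum false after) ∨
        (regVal cols (.sum true after) = regVal cols (.sum false after) ∧ cmp after = true) := by
  induction l generalizing carry cmp with
  | nil => exact ⟨carry, cmp, [], rfl, rfl, rfl, fun r => by simp [regVal],
      fun r => by simp [regVal]⟩
  | cons x l ih =>
    obtain ⟨c1, p1, cols, h1, h2, h3, h4, h5⟩ := ih
      (fun r => decide (radix ≤ G.total op i carry x r))
      (fun after =>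
        decide (G.total op i carry x (.sum true after) % radix <
          G.total op i carry x (.sum false after) % radix) ||
        (decide (G.total op i carry x (.sum true after) % radix =
          G.total op i carry x (.sum false after) % radix) && cmp after))
    have hval : ∀ r, regVal (((fun r => Fin.ofNat radix (G.total op i carry x r), x.2.2) :
        Column G.tracks) :: cols) r = G.total op i carry x r % radix + radix * regVal cols r := by
      intro r
      simp [regVal, Nat.ofDigits_cons]
    refine ⟨c1, p1, (fun r => Fin.ofNat radix (G.total op i carry x r), x.2.2) :: cols, ?_,
      by simp [h2], by simp [h3], ?_, ?_⟩
    · rw [runPass]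
      simp only [pass]
      rw [h1]
    · intro r
      rw [hval]
      have h6 := h4 r
      have hdig : ∀ o, G.operandDigit i x o < radix := by
        intro o
        cases o with
        | zero => exact NeZero.pos _
        | guess => exact Fin.is_lt _
        | reg r => exact Fin.is_lt _
      -- Two digits and a carry bit stay below 2·radix, so the new carry is a bit again.
      have hmod : G.total op i carry x r % radix +
          radix * (decide (radix ≤ G.total op i carry x r)).toNat = G.total op i carry x r := by
        have ha := hdig (op r).1
        have hb := hdig (op r).2.1
        have hc : (carry r).toNat ≤ 1 := Bool.toNat_le _
        have hlt : G.total op i carry x r < 2 * radix := by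
          unfold total
          omega
        by_cases hle : radix ≤ G.total op i carry x r
        · rw [Nat.mod_eq_sub_mod hle, Nat.mod_eq_of_lt (by omega)]
          simp only [hle, decide_true, Bool.toNat_true]
          omega
        · rw [Nat.mod_eq_of_lt (by omega)]
          simp [hle]
      simp only [List.map_cons, Nat.ofDigits_cons, List.length_cons, pow_succ]
      calc _ = G.total op i carry x r % radix +
            radix * (regVal cols r + radix ^ l.length * (c1 r).toNat) := by ring
        _ = (G.total op i carry x r % radix +
            radix * (decide (radix ≤ G.total op i carry x r)).toNat) + radix *
            (Nat.ofDigits radix (l.map fun x => G.operandDigit i x (op r).1) +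
              Nat.ofDigits radix (l.map fun x => G.operandDigit i x (op r).2.1)) := by
          rw [h6]
          ring
        _ = _ := by
          rw [hmod, total]
          ring
    · intro after
      rw [h5, hval, hval]
      have ha := Nat.mod_lt (G.total op i carry x (.sum true after)) (NeZero.pos radix)
      have hb := Nat.mod_lt (G.total op i carry x (.sum false after)) (NeZero.pos radix)
      generalize G.total op i carry x (.sum true after) % radix = a at *
      generalize G.total op i carry x (.sum false after) % radix = b at *
      generalize regVal cols (.sum true after) = A
      generalize regVal cols (.sum false after) = B
      simp only [Bool.or_eq_true, Bool.and_eq_true, decide_eq_true_eq]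
      rcases lt_trichotomy A B with h | h | h
      · have : radix * (A + 1) ≤ radix * B := Nat.mul_le_mul_left _ h
        rw [mul_add, mul_one] at this
        constructor
        · exact fun _ => Or.inl (by omega)
        · exact fun _ => Or.inl h
      · subst h
        simp
      · have : radix * (B + 1) ≤ radix * A := Nat.mul_le_mul_left _ h
        rw [mul_add, mul_one] at this
        constructor
        · rintro (h' | ⟨h', -⟩) <;> omega
        · rintro (h' | ⟨h', -⟩) <;> omega

/-- The effect of a register operation. -/
theorem run_sweepOf (op : RegOp) (i : Fin (G.tracks + 3)) (s : ParseState) (m : Fin (G.tracks + 3))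
    (ovf : Bool) (l : List (G.Ch × Column G.tracks)) :
    ∃ carry cmp cols, runPass (G.pass dbl) (G.sweepOf op i s m ovf) l =
        (Sweep.arith op i carry cmp s m ovf, cols) ∧
      cols.length = l.length ∧ cols.map Prod.snd = (l.map Prod.snd).map Prod.snd ∧
      (∀ r, regVal cols r + radix ^ l.length * (carry r).toNat =
        op.eval (regVal (l.map Prod.snd)) (G.guessVal i l) r) ∧
      ∀ after, cmp after = true ↔
        regVal cols (.sum true after) ≤ regVal cols (.sum false after) := by
  obtain ⟨carry, cmp, cols, h1, h2, h3, h4, h5⟩ := G.run_arith dbl op i (fun r => (op r).2.2)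
    (fun _ => true) s m ovf l
  refine ⟨carry, cmp, cols, h1, h2, h3, fun r => ?_, fun after => ?_⟩
  · rw [h4, ofDigits_operandDigit, ofDigits_operandDigit]
    rfl
  · rw [h5, le_iff_lt_or_eq]
    simp

end GuessMode

/-! ### Properties of the configurations to which all computations lead. -/

namespace OfflineTM

variable {α : Type} (M : OfflineTM α) (w : List α) (b : ℕ)

/-- All computations from `C` lead to configurations with the property `p`. -/
def Leads (C : M.Config) (p : M.Config → Prop) : Prop :=
  ∃ S, M.Exact w b C S ∧ S.Nonempty ∧ ∀ D ∈ S, p D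

variable {M w b}

theorem Leads.of_self {C : M.Config} {p : M.Config → Prop} (h : p C) : M.Leads w b C p :=
  ⟨{C}, .refl C, Set.singleton_nonempty C, fun D hD => by rwa [Set.mem_singleton_iff.1 hD]⟩

theorem Leads.mono {C : M.Config} {p q : M.Config → Prop} (h : M.Leads w b C p)
    (hpq : ∀ D, p D → q D) : M.Leads w b C q := by
  obtain ⟨S, h1, h2, h3⟩ := h
  exact ⟨S, h1, h2, fun D hD => hpq D (h3 D hD)⟩

theorem Exact.leads {C D : M.Config} {p : M.Config → Prop} (h : M.Exact w b C {D})
    (hD : M.Leads w b D p) : M.Leads w b C p := by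
  obtain ⟨S, h1, h2, h3⟩ := hD
  exact ⟨S, h.trans_singleton h1, h2, h3⟩

theorem Exact.leads_of_forall {ι : Type*} {C : M.Config} {p : ι → Prop} {f : ι → M.Config}
    {q : M.Config → Prop} (h : M.Exact w b C {D | ∃ i, p i ∧ D = f i}) (hne : ∃ i, p i)
    (hq : ∀ i, p i → M.Leads w b (f i) q) : M.Leads w b C q := by
  have hq' : ∀ i, ∃ S, p i → M.Exact w b (f i) S ∧ S.Nonempty ∧ ∀ D ∈ S, q D := by
    intro i
    by_cases hi : p i
    · obtain ⟨S, hS⟩ := hq i hi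
      exact ⟨S, fun _ => hS⟩
    · exact ⟨∅, fun h => (hi h).elim⟩
  choose T hT using hq'
  refine ⟨_, h.bind (fun i hi => (hT i hi).1), ?_, ?_⟩
  · obtain ⟨i, hi⟩ := hne
    obtain ⟨D, hD⟩ := (hT i hi).2.1
    exact ⟨D, i, hi, hD⟩
  · rintro D ⟨i, hi, hD⟩
    exact (hT i hi).2.2 D hD

end OfflineTM

theorem inputCellAt_end {α : Type} (w : List α) : inputCellAt w (w.length + 1) = .rightEnd := by
  simp [inputCellAt]

theorem inputCellAt_append {α : Type} (v : List α) (a : α) (u : List α) :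
    inputCellAt (v ++ a :: u) (v.length + 1) = .letter a := by
  simp [inputCellAt]

theorem inputCellAt_ne_rightEnd {α : Type} {w : List α} {i : ℕ} (h : i ≤ w.length) :
    inputCellAt w i ≠ .rightEnd := by
  rcases i with _ | i
  · simp [inputCellAt]
  · simp [inputCellAt, List.getElem?_eq_getElem (show i < w.length by omega)]

/-! ### Marking off the work space. -/

/-- The space in which the machine works. -/
def spaceBound (dbl : Bool) (l : ℕ) : ℕ := if dbl then l else Nat.log 2 l

/-- The columns that have been marked off after `i` steps. -/
def Sized (dbl : Bool) {n : ℕ} (i : ℕ) (cols : List (Column n)) : Prop :=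
  (∀ t ∈ cols.map Prod.snd, t = zeroTracks n) ∧
    if dbl then cols.length = i
    -- The inequality says that the counter has no superfluous columns; the summand 1 allows for i =
    -- 0 with no column.
    else Nat.ofDigits 2 (cols.map sizeBit) = i ∧ 2 ^ cols.length ≤ 2 * i + 1

theorem Sized.length_lt {dbl : Bool} {n i l : ℕ} {cols : List (Column n)} (h : Sized dbl i cols)
    (hi : i ≤ l + 1) : cols.length + 1 < spaceBound dbl l + 5 := by
  cases dbl
  · have h1 : 2 ^ cols.length ≤ 2 * i + 1 := h.2.2
    have h2 : l < 2 ^ (Nat.log 2 l + 1) := Nat.lt_pow_succ_log_self (by norm_num) l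
    have h3 : 2 ^ cols.length < 2 ^ (Nat.log 2 l + 3) := by
      rw [pow_succ] at h2
      rw [pow_add]
      omega
    have h4 := (Nat.pow_lt_pow_iff_right (by norm_num)).1 h3
    simp only [spaceBound, Bool.false_eq_true, if_false]
    omega
  · have h1 : cols.length = i := h.2
    simp only [spaceBound, if_true]
    omega

/-- For unary input the counter shows l + 1, which is `digitBound dbl l`, and a counter of W bits
stays below 2^W. For binary input W = l + 1. -/
theorem Sized.digitBound_le {dbl : Bool} {n l : ℕ} {cols : List (Column n)}
    (h : Sized dbl (l + 1) cols) : digitBound dbl l ≤ 2 ^ cols.length := by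
  cases dbl
  · have h1 : Nat.ofDigits 2 (cols.map sizeBit) = l + 1 := h.2.1
    simp only [digitBound, Bool.false_eq_true, if_false, ← h1]
    have h2 := Nat.ofDigits_lt_base_pow_length (b := 2) (l := cols.map sizeBit) (by norm_num) (by
      intro x hx
      obtain ⟨c, -, rfl⟩ := List.mem_map.1 hx
      unfold sizeBit
      split_ifs <;> norm_num)
    rw [List.length_map] at h2
    exact h2.le
  · have h1 : cols.length = l + 1 := h.2
    simp only [digitBound, if_true, h1]
    exact Nat.pow_le_pow_right (by norm_num) (by omega)

namespace GuessMode

variable (G : GuessMode) (dbl : Bool) (acc : Set (Control G.tracks))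

theorem exists_choices (cols : List (Column G.tracks)) :
    ∃ l : List (G.Ch × Column G.tracks), l.map Prod.snd = cols := by
  obtain ⟨ch⟩ := G.nonempty_Ch
  exact ⟨cols.map fun c => (ch, c), by simp [Function.comp_def]⟩

theorem exists_sized_succ {i : ℕ} {cols : List (Column G.tracks)} (h : Sized dbl i cols) :
    ∃ s cols', (∀ l : List (G.Ch × Column G.tracks), l.map Prod.snd = cols →
        runPass (G.pass dbl) (.size true) l = (s, cols')) ∧ G.finish s = .size ∧
      Sized dbl (i + 1) (cols' ++ (G.extend s).toList) := by
  obtain ⟨h1, h2⟩ := h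
  obtain ⟨l, hl⟩ := G.exists_choices cols
  cases dbl
  · simp only [Bool.false_eq_true, if_false] at h2
    obtain ⟨carry, cols', h3, h4, h5, h6⟩ := G.run_size_false true l
    have h7 : l.length = cols.length := by rw [← hl, List.length_map]
    rw [hl] at h3 h5 h6
    rw [h7] at h4 h6
    refine ⟨.size carry, cols', h3, rfl, ?_⟩
    cases carry
    · simp only [Bool.toNat_false, Bool.toNat_true, mul_zero, add_zero] at h6
      simp only [extend, Option.toList_none, List.append_nil]
      refine ⟨by rwa [h5], ?_⟩
      simp only [Bool.false_eq_true, if_false]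
      rw [h4, h6]
      omega
    · have hone : (Fin.ofNat radix 1) ≠ 0 := by
        have : radix ≠ 1 := one_lt_radix.ne'
        simp [this]
      simp only [Bool.toNat_true, mul_one] at h6
      simp only [extend, Option.toList_some]
      refine ⟨?_, ?_⟩
      · rw [List.map_append, h5]
        intro t ht
        rcases List.mem_append.1 ht with ht | ht
        · exact h1 t ht
        · simpa using ht
      · simp only [Bool.false_eq_true, if_false, List.map_append, Nat.ofDigits_append,
          List.length_map, List.length_append, List.map_cons, List.map_nil, List.length_singleton,
          sizeBit, hone, Nat.ofDigits_singleton, mul_one, pow_succ]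
        rw [h4]
        omega
  · simp only [if_true] at h2
    refine ⟨.size true, cols, fun l hl => ?_, rfl, ?_, ?_⟩
    · rw [G.run_size_true, hl]
    · rw [List.map_append]
      intro t ht
      rcases List.mem_append.1 ht with ht | ht
      · exact h1 t ht
      · simpa [extend] using ht
    · simp [extend, h2]

/-- A configuration between two sweeps. -/
noncomputable def between (q : Control G.tracks) (i : ℕ) (cols : List (Column G.tracks)) :
    (G.machine dbl acc).toTM.Config :=
  (G.machine dbl acc).config (.idle q) i cols 0

variable {w : List InSym} {b : ℕ}

theorem exact_between {q : Control G.tracks} {s : Sweep G.tracks} {mv : HeadMove} {i : ℕ}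
    {cols : List (Column G.tracks)} (h : G.launch dbl q (inputCellAt w i) = some (s, mv))
    (hb : cols.length + 1 < b) :
    (G.machine dbl acc).toTM.Exact w b (G.between dbl acc q i cols)
      {C | ∃ l : List (G.Ch × Column G.tracks), l.map Prod.snd = cols ∧
        C = G.between dbl acc (G.finish (runPass (G.pass dbl) s l).1)
          (min (mv.apply i) (w.length + 1))
          ((runPass (G.pass dbl) s l).2 ++ (G.extend (runPass (G.pass dbl) s l).1).toList)} :=
  PassMachine.exact_round h hb

theorem exact_between_singleton {q : Control G.tracks} {s s' : Sweep G.tracks} {mv : HeadMove}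
    {i : ℕ} {cols cols' : List (Column G.tracks)}
    (h : G.launch dbl q (inputCellAt w i) = some (s, mv)) (hb : cols.length + 1 < b)
    (hr : ∀ l : List (G.Ch × Column G.tracks), l.map Prod.snd = cols →
      runPass (G.pass dbl) s l = (s', cols')) :
    (G.machine dbl acc).toTM.Exact w b (G.between dbl acc q i cols)
      {G.between dbl acc (G.finish s') (min (mv.apply i) (w.length + 1))
        (cols' ++ (G.extend s').toList)} := by
  convert G.exact_between dbl acc h hb using 1
  ext C
  constructor
  · rintro rfl
    obtain ⟨l, hl⟩ := G.exists_choices cols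
    exact ⟨l, hl, by rw [hr l hl]⟩
  · rintro ⟨l, hl, rfl⟩
    rw [hr l hl]
    rfl

/-- Sizing counts every input cell before the right end mark, including the left end mark, whence ℓ
+ 1. -/
theorem exact_size {i : ℕ} {cols : List (Column G.tracks)} (hi : i ≤ w.length + 1)
    (h : Sized dbl i cols) :
    ∃ cols', Sized dbl (w.length + 1) cols' ∧
      (G.machine dbl acc).toTM.Exact w (spaceBound dbl w.length + 5)
        (G.between dbl acc .size i cols) {G.between dbl acc .rewind w.length cols'} := by
  obtain ⟨d, hd⟩ : ∃ d, i + d = w.length + 1 := ⟨w.length + 1 - i, by omega⟩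
  induction d generalizing i cols with
  | zero =>
    obtain rfl : i = w.length + 1 := hd
    refine ⟨cols, h, ?_⟩
    have h1 := G.exact_between_singleton dbl acc (w := w) (q := .size) (s := .keep) (mv := .left)
      (s' := .keep) (cols' := cols) (by rw [inputCellAt_end]; rfl) (h.length_lt le_rfl)
      (fun l hl => by rw [run_keep, hl])
    simpa [HeadMove.apply, extend, finish] using h1
  | succ d ih =>
    obtain ⟨s, cols1, h1, h2, h3⟩ := G.exists_sized_succ dbl h
    obtain ⟨cols', h4, h5⟩ := ih (i := i + 1) (by omega) h3 (by omega)
    refine ⟨cols', h4, ?_⟩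
    have hcell := inputCellAt_ne_rightEnd (w := w) (i := i) (by omega)
    have h6 := G.exact_between_singleton dbl acc (w := w) (q := .size) (s := .size true)
      (mv := .right) (i := i) (by
        generalize inputCellAt w i = c at hcell
        cases c
        · rfl
        · rfl
        · exact (hcell rfl).elim) (h.length_lt hi) h1
    rw [HeadMove.apply, min_eq_left (by omega), h2] at h6
    exact h6.trans_singleton h5

theorem exact_rewind {i : ℕ} {cols : List (Column G.tracks)} (hi : i ≤ w.length + 1)
    (hb : cols.length + 1 < b) :
    (G.machine dbl acc).toTM.Exact w b (G.between dbl acc .rewind i cols)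
      {G.between dbl acc .rewind 0 cols} := by
  induction i with
  | zero => exact OfflineTM.Exact.refl _
  | succ i ih =>
    have h1 := G.exact_between_singleton dbl acc (w := w) (q := .rewind) (s := .keep) (mv := .left)
      (i := i + 1) (s' := .keep) (cols' := cols) (by
        have : inputCellAt w (i + 1) ≠ .leftEnd := by
          simp only [inputCellAt]
          split <;> simp
        generalize inputCellAt w (i + 1) = c at this
        cases c
        · exact (this rfl).elim
        · rfl
        · rfl) hb (fun l hl => by rw [run_keep, hl])
    rw [HeadMove.apply, min_eq_left (by omega)] at h1
    simp only [extend, Option.toList_none, List.append_nil, finish, Nat.add_sub_cancel] at h1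
    exact h1.trans_singleton (ih (by omega))

/-! ### Scanning the input -/

/-- The state of the scan and the columns after a register operation. -/
theorem exists_scan_of_sweepOf (op : RegOp) (i : Fin (G.tracks + 3)) (s : ParseState)
    (m : Fin (G.tracks + 3)) (ovf : Bool) (l : List (G.Ch × Column G.tracks)) :
    ∃ p : ScanState G.tracks × List (Column G.tracks),
      G.finish (runPass (G.pass dbl) (G.sweepOf op i s m ovf) l).1 = .scan p.1 ∧
      (runPass (G.pass dbl) (G.sweepOf op i s m ovf) l).2 = p.2 ∧
      G.extend (runPass (G.pass dbl) (G.sweepOf op i s m ovf) l).1 = none ∧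
      p.1.1 = s ∧ p.1.2.1 = m ∧ p.2.length = l.length ∧
      p.2.map Prod.snd = (l.map Prod.snd).map Prod.snd ∧
      (p.1.2.2.1 = false → ovf = false ∧
        ∀ r, regVal p.2 r = op.eval (regVal (l.map Prod.snd)) (G.guessVal i l) r) ∧
      (p.1.2.2.2 = true ↔ regVal p.2 (.sum true false) ≤ regVal p.2 (.sum false false) ∧
        ¬ regVal p.2 (.sum true true) ≤ regVal p.2 (.sum false true)) ∧
      (ovf = false →
        (∀ r, op.eval (regVal (l.map Prod.snd)) (G.guessVal i l) r < radix ^ l.length) →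
        p.1.2.2.1 = false) := by
  obtain ⟨carry, cmp, cols, h1, h2, h3, h4, h5⟩ := G.run_sweepOf dbl op i s m ovf l
  refine ⟨((s, m, ovf || decide (∃ r, carry r = true), cmp false && !cmp true), cols), ?_⟩
  rw [h1]
  refine ⟨rfl, rfl, rfl, rfl, rfl, h2, h3, ?_, ?_, ?_⟩
  · intro h
    simp only [Bool.or_eq_false_iff, decide_eq_false_iff_not, not_exists, Bool.not_eq_true] at h
    refine ⟨h.1, fun r => ?_⟩
    rw [← h4, h.2 r]
    simp
  · simp only [Bool.and_eq_true, Bool.not_eq_true', ← h5, Bool.not_eq_true]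
  · intro h h6
    simp only [h, Bool.false_or, decide_eq_false_iff_not, not_exists, Bool.not_eq_true]
    intro r
    have h7 := h6 r
    rw [← h4] at h7
    by_contra h8
    rw [Bool.not_eq_false] at h8
    rw [h8, Bool.toNat_true] at h7
    omega

/-- The machine can get from `p` to `p'` by scanning a word, with guesses `x`. -/
def ScanRun : List InSym → (ℕ → ℕ) → ScanState G.tracks × List (Column G.tracks) →
    ScanState G.tracks × List (Column G.tracks) → Prop
  | [], _, p, p' => p' = p
  | a :: u, x, p, p' => ∃ (l : List (G.Ch × Column G.tracks))
      (p1 : ScanState G.tracks × List (Column G.tracks)), l.map Prod.snd = p.2 ∧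
      G.finish (runPass (G.pass dbl) (G.letterSweep dbl p.1 a) l).1 = .scan p1.1 ∧
      (runPass (G.pass dbl) (G.letterSweep dbl p.1 a) l).2 = p1.2 ∧
      (isGuess p.1.1 a = true → G.guessVal p.1.2.1 l = x 0) ∧
      ScanRun u (if isGuess p.1.1 a then fun i => x (i + 1) else x) p1 p'

/-- The machine stores no sequence of guesses: `y.1` is assembled afterwards from the choices made
in the sweeps that consume a guess. -/
theorem exact_scan (u v : List InSym) (hw : w = v ++ u)
    (p : ScanState G.tracks × List (Column G.tracks)) (hb : p.2.length + 1 < b) :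
    (G.machine dbl acc).toTM.Exact w b (G.between dbl acc (.scan p.1) (v.length + 1) p.2)
      {C | ∃ y : (ℕ → ℕ) × (ScanState G.tracks × List (Column G.tracks)),
        G.ScanRun dbl u y.1 p y.2 ∧
          C = G.between dbl acc (.scan y.2.1) (w.length + 1) y.2.2} := by
  induction u generalizing v p with
  | nil =>
    convert OfflineTM.Exact.refl _ using 1
    ext C
    constructor
    · rintro ⟨⟨x, p'⟩, h, rfl⟩
      cases h
      simp [hw]
    · rintro rfl
      exact ⟨⟨fun _ => 0, p⟩, rfl, by simp [hw]⟩
  | cons a u ih =>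
    have h1 := G.exact_between dbl acc (w := w) (b := b) (q := .scan p.1)
      (s := G.letterSweep dbl p.1 a) (mv := .right) (i := v.length + 1) (cols := p.2)
      (by rw [hw, inputCellAt_append]; rfl) hb
    have hres := fun l => G.exists_scan_of_sweepOf dbl (letterOp dbl p.1.1 a) p.1.2.1
      (nextState dbl p.1.1 a) (if isGuess p.1.1 a then bumpCount p.1.2.1 else p.1.2.1) p.1.2.2.1 l
    -- The result of a sweep is a function of the choices, so the configurations after one letter
    -- are indexed by `l`.
    choose f hf using hres
    have h2 := h1.bind (T := fun l => {C | ∃ y : (ℕ → ℕ) × (ScanState G.tracks ×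
      List (Column G.tracks)), G.ScanRun dbl u y.1 (f l) y.2 ∧
          C = G.between dbl acc (.scan y.2.1) (w.length + 1) y.2.2}) (by
        intro l hl
        have h3 := ih (v ++ [a]) (by simp [hw]) (f l) (by
          rw [(hf l).2.2.2.2.2.1, ← List.length_map (f := Prod.snd), hl]
          exact hb)
        have e1 : G.finish (runPass (G.pass dbl) (G.letterSweep dbl p.1 a) l).1 = .scan (f l).1 :=
          (hf l).1
        have e2 : (runPass (G.pass dbl) (G.letterSweep dbl p.1 a) l).2 = (f l).2 := (hf l).2.1
        have e3 : G.extend (runPass (G.pass dbl) (G.letterSweep dbl p.1 a) l).1 = none :=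
          (hf l).2.2.1
        have e4 : min (HeadMove.right.apply (v.length + 1)) (w.length + 1) =
            (v ++ [a]).length + 1 := by
          simp [HeadMove.apply, hw]
        rw [e1, e2, e3, e4, Option.toList_none, List.append_nil]
        exact h3)
    convert h2 using 1
    ext C
    constructor
    · rintro ⟨⟨x, p'⟩, ⟨l, p1, hl, h3, h4, -, h6⟩, rfl⟩
      refine ⟨l, hl, ⟨if isGuess p.1.1 a then fun i => x (i + 1) else x, p'⟩, ?_, rfl⟩
      have e : p1 = f l := by
        have e1 := (hf l).1.symm.trans h3
        have e2 := (hf l).2.1.symm.trans h4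
        simp only [Control.scan.injEq] at e1
        exact (Prod.ext e1 e2).symm
      rw [← e]
      exact h6
    · rintro ⟨l, hl, ⟨x, p'⟩, h3, rfl⟩
      by_cases hg : isGuess p.1.1 a = true
      · refine ⟨⟨fun i => Nat.casesOn i (G.guessVal p.1.2.1 l) x, p'⟩, ⟨l, f l, hl, (hf l).1,
          (hf l).2.1, fun _ => rfl, ?_⟩, rfl⟩
        rw [if_pos hg]
        exact h3
      · refine ⟨⟨x, p'⟩, ⟨l, f l, hl, (hf l).1, (hf l).2.1, fun h => (hg h).elim, ?_⟩, rfl⟩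
        rw [if_neg hg]
        exact h3

variable {G dbl}

/-- The tape agrees with the evaluation unless there was an overflow. -/
structure Agrees (W : ℕ) (t : List (Fin G.tracks → Fin radix))
    (p : ScanState G.tracks × List (Column G.tracks)) (e : EvalState) : Prop where
  length : p.2.length = W
  tracks : p.2.map Prod.snd = t
  parse : p.1.1 = e.1
  count : (p.1.2.1 : ℕ) = min e.2.1 (G.tracks + 2)
  val : p.1.2.2.1 = false → ∀ r, regVal p.2 r = e.2.2 r
  hit : p.1.2.2.2 = true ↔ regVal p.2 (.sum true false) ≤ regVal p.2 (.sum false false) ∧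
    ¬ regVal p.2 (.sum true true) ≤ regVal p.2 (.sum false true)

/-- The operand `guess` occurs only in `sepOp .const` and `sepOp .post`, the end marks at which
`isGuess` holds. -/
theorem letterOp_eval_of_not_isGuess {s : ParseState} {a : InSym} (h : isGuess s a = false)
    (V : Reg → ℕ) (x y : ℕ) : (letterOp dbl s a).eval V x = (letterOp dbl s a).eval V y := by
  funext r
  rcases s with _ | ⟨f, s, g⟩
  · rfl
  · cases a with
    | minus => rfl
    | zero =>
      rcases r with ⟨neg, after⟩ | _ | _ | _ <;>
        simp only [letterOp, RegOp.eval, digitOp] <;> split_ifs <;> rfl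
    | one =>
      rcases r with ⟨neg, after⟩ | _ | _ | _ <;>
        simp only [letterOp, RegOp.eval, digitOp] <;> split_ifs <;> rfl
    | sep =>
      cases f
      · cases h
      · rcases r with ⟨neg, after⟩ | _ | _ | _ <;> rfl
      · rcases r with ⟨neg, after⟩ | _ | _ | _ <;> rfl
      · cases h

/-- One letter of a scan. -/
theorem Agrees.step {W : ℕ} {t : List (Fin G.tracks → Fin radix)}
    {p p1 : ScanState G.tracks × List (Column G.tracks)} {e : EvalState} (h : Agrees W t p e)
    {a : InSym} {l : List (G.Ch × Column G.tracks)} (hl : l.map Prod.snd = p.2)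
    (h1 : G.finish (runPass (G.pass dbl) (G.letterSweep dbl p.1 a) l).1 = .scan p1.1)
    (h2 : (runPass (G.pass dbl) (G.letterSweep dbl p.1 a) l).2 = p1.2) {g : ℕ}
    (hg : isGuess p.1.1 a = true → G.guessVal p.1.2.1 l = g) :
    Agrees W t p1 (nextState dbl e.1 a, if isGuess e.1 a then e.2.1 + 1 else e.2.1,
        (letterOp dbl e.1 a).eval e.2.2 g) ∧
      (p.1.2.2.1 = false → (∀ r, (letterOp dbl e.1 a).eval e.2.2 g r < radix ^ W) →
        p1.1.2.2.1 = false) := by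
  obtain ⟨q, q1, q2, -, q3, q4, q5, q6, q7, q8, q9⟩ := G.exists_scan_of_sweepOf dbl
    (letterOp dbl p.1.1 a) p.1.2.1 (nextState dbl p.1.1 a)
    (if isGuess p.1.1 a then bumpCount p.1.2.1 else p.1.2.1) p.1.2.2.1 l
  have hq : q = p1 := by
    have e1 := q1.symm.trans h1
    have e2 := q2.symm.trans h2
    simp only [Control.scan.injEq] at e1
    exact Prod.ext e1 e2
  subst hq
  have hlen : l.length = W := by rw [← h.length, ← hl, List.length_map]
  rw [hl] at q6 q7 q9
  have hev : p.1.2.2.1 = false →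
      (letterOp dbl p.1.1 a).eval (regVal p.2) (G.guessVal p.1.2.1 l) =
        (letterOp dbl e.1 a).eval e.2.2 g := by
    intro hov
    have e1 : regVal p.2 = e.2.2 := funext (h.val hov)
    rw [e1, ← h.parse]
    by_cases hgu : isGuess p.1.1 a = true
    · rw [hg hgu]
    · exact letterOp_eval_of_not_isGuess (by simpa using hgu) _ _ _
  refine ⟨⟨by rw [q5, hlen], by rw [q6, h.tracks], by rw [q3, h.parse], ?_, ?_, q8⟩, ?_⟩
  · rw [q4, h.parse]
    have := h.count
    split_ifs
    · simp only [bumpCount]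
      omega
    · exact this
  · intro hov r
    obtain ⟨h3, h4⟩ := q7 hov
    rw [h4, hev h3]
  · intro hov hb
    refine q9 hov fun r => ?_
    rw [hev hov, hlen]
    exact hb r

theorem ScanRun.agrees {u : List InSym} {x : ℕ → ℕ} {W : ℕ} {t : List (Fin G.tracks → Fin radix)}
    {p p' : ScanState G.tracks × List (Column G.tracks)} {e : EvalState}
    (h : G.ScanRun dbl u x p p') (hp : Agrees W t p e) :
    Agrees W t p' (evalWord dbl u x e) := by
  induction u generalizing x p e with
  | nil =>
    cases h
    exact hp
  | cons a u ih =>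
    obtain ⟨l, p1, hl, h1, h2, h3, h4⟩ := h
    have h5 := ih h4 (hp.step hl h1 h2 h3).1
    rw [hp.parse] at h5
    exact h5

/-- With `j` letters already read, `RegBound` keeps every later register value below the capacity
radix^W. -/
theorem ScanRun.no_overflow {u : List InSym} {x : ℕ → ℕ} {W : ℕ}
    {t : List (Fin G.tracks → Fin radix)}
    {p p' : ScanState G.tracks × List (Column G.tracks)} {e : EvalState} {Y j : ℕ}
    (h : G.ScanRun dbl u x p p') (hp : Agrees W t p e) (hov : p.1.2.2.1 = false)
    (hV : RegBound dbl Y j e.2.2) (hY : digitBound dbl (j + u.length) ≤ Y) (hx : ∀ i, x i ≤ Y)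
    (hlt : Y * digitBound dbl (j + u.length) < radix ^ W) : p'.1.2.2.1 = false := by
  induction u generalizing x p e j with
  | nil =>
    cases h
    exact hov
  | cons a u ih =>
    obtain ⟨l, p1, hl, h1, h2, h3, h4⟩ := h
    have h5 := hp.step hl h1 h2 h3
    have e1 : j + (a :: u).length = j + 1 + u.length := by
      rw [List.length_cons]
      omega
    rw [e1] at hY hlt
    have hY0 : 0 < Y := lt_of_lt_of_le (by omega) ((le_digitBound dbl (j + 1 + u.length)).trans hY)
    have h6 := hV.letterOp ((digitBound_mono dbl (by omega)).trans hY) e.1 a (hx 0)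
    refine ih h4 h5.1 (h5.2 hov fun r => ?_) h6 hY (fun i => ?_) hlt
    · exact ((h6.le hY0 r).trans (Nat.mul_le_mul_left _ (digitBound_mono dbl (by omega)))).trans_lt
        hlt
    · split_ifs
      · exact hx _
      · exact hx _

theorem exists_scanRun (u : List InSym) (p : ScanState G.tracks × List (Column G.tracks)) :
    ∃ x p', G.ScanRun dbl u x p p' := by
  induction u generalizing p with
  | nil => exact ⟨fun _ => 0, p, rfl⟩
  | cons a u ih =>
    obtain ⟨l, hl⟩ := G.exists_choices p.2
    obtain ⟨p1, h1, h2, -⟩ := G.exists_scan_of_sweepOf dbl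
      (letterOp dbl p.1.1 a) p.1.2.1 (nextState dbl p.1.1 a)
      (if isGuess p.1.1 a then bumpCount p.1.2.1 else p.1.2.1) p.1.2.2.1 l
    obtain ⟨x, p', h3⟩ := ih p1
    by_cases hg : isGuess p.1.1 a = true
    · refine ⟨fun i => Nat.casesOn i (G.guessVal p.1.2.1 l) x, p', l, p1, hl, h1, h2, fun _ => rfl,
        ?_⟩
      rw [if_pos hg]
      exact h3
    · refine ⟨x, p', l, p1, hl, h1, h2, fun h => (hg h).elim, ?_⟩
      rw [if_neg hg]
      exact h3

/-- Every sequence of multiplicities can be guessed by choosing digits. -/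
theorem exists_scanRun_of_choice
    (hG : ∀ i t d, ∃ c, G.digit i c t = d) (u : List InSym) (x : ℕ → ℕ)
    (p : ScanState G.tracks × List (Column G.tracks)) (hx : ∀ i, x i < radix ^ p.2.length) :
    ∃ p', G.ScanRun dbl u x p p' := by
  induction u generalizing p x with
  | nil => exact ⟨p, rfl⟩
  | cons a u ih =>
    -- The digits of `y` are chosen column by column.
    have hl : ∀ (cols : List (Column G.tracks)) (y : ℕ), y < radix ^ cols.length →
        ∃ l : List (G.Ch × Column G.tracks), l.map Prod.snd = cols ∧
          G.guessVal p.1.2.1 l = y := by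
      intro cols
      induction cols with
      | nil =>
        intro y hy
        refine ⟨[], rfl, ?_⟩
        simp at hy
        simp [guessVal, hy]
      | cons c cols ihc =>
        intro y hy
        obtain ⟨l, h1, h2⟩ := ihc (y / radix) (Nat.div_lt_of_lt_mul (by
          rwa [List.length_cons, pow_succ, mul_comm] at hy))
        obtain ⟨ch, hch⟩ := hG p.1.2.1 c.2 ⟨y % radix, Nat.mod_lt _ (NeZero.pos _)⟩
        refine ⟨(ch, c) :: l, by simp [h1], ?_⟩
        simp only [guessVal] at h2
        simp only [guessVal, List.map_cons, Nat.ofDigits_cons, hch, h2]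
        exact Nat.mod_add_div y radix
    obtain ⟨l, hl, hlx⟩ := hl p.2 (x 0) (hx 0)
    obtain ⟨p1, h1, h2, -, -, -, h3, -⟩ := G.exists_scan_of_sweepOf dbl
      (letterOp dbl p.1.1 a) p.1.2.1 (nextState dbl p.1.1 a)
      (if isGuess p.1.1 a then bumpCount p.1.2.1 else p.1.2.1) p.1.2.2.1 l
    have h4 : p1.2.length = p.2.length := by rw [h3, ← hl, List.length_map]
    obtain ⟨p', h5⟩ := ih (if isGuess p.1.1 a then fun i => x (i + 1) else x) p1 (by
      rw [h4]
      intro i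
      split_ifs
      · exact hx _
      · exact hx _)
    exact ⟨p', l, p1, hl, h1, h2, fun _ => hlx, h5⟩

/-- The number on a track. -/
def trackVal {n : ℕ} (t : List (Fin n → Fin radix)) (i : ℕ) : ℕ :=
  if h : i < n then Nat.ofDigits radix (t.map fun c => (c ⟨i, h⟩ : ℕ)) else 0

/-- If the multiplicities are read off the tracks, then the guesses are determined. -/
theorem ScanRun.trackVal
    (hG : ∀ i c t, G.digit i c t = if h : (i : ℕ) < G.tracks then t ⟨i, h⟩ else 0)
    {u : List InSym} {x : ℕ → ℕ} {W : ℕ} {t : List (Fin G.tracks → Fin radix)}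
    {p p' : ScanState G.tracks × List (Column G.tracks)} {e : EvalState}
    (h : G.ScanRun dbl u x p p') (hp : Agrees W t p e) :
    G.ScanRun dbl u (fun i => GuessMode.trackVal t (e.2.1 + i)) p p' := by
  induction u generalizing x p e with
  | nil => exact h
  | cons a u ih =>
    obtain ⟨l, p1, hl, h1, h2, h3, h4⟩ := h
    have h5 := ih h4 (hp.step hl h1 h2 h3).1
    refine ⟨l, p1, hl, h1, h2, fun _ => ?_, ?_⟩
    · have hc := hp.count
      have ht : t = l.map fun y => y.2.2 := by
        rw [← hp.tracks, ← hl, List.map_map]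
        rfl
      simp only [guessVal, hG, GuessMode.trackVal, add_zero]
      -- The count on the machine differs from the true one only after saturation, and there both
      -- yield the guess 0.
      by_cases h6 : e.2.1 < G.tracks
      · have h7 : (p.1.2.1 : ℕ) = e.2.1 := by omega
        simp only [h7, h6, dif_pos, ht, List.map_map]
        rfl
      · have h7 : ¬ (p.1.2.1 : ℕ) < G.tracks := by omega
        simp only [h7, h6, dif_neg, not_false_eq_true]
        exact ofDigits_map_zero _ _
    · rw [hp.parse]
      convert h5 using 2
      split_ifs
      · exact congrArg (GuessMode.trackVal t) (by simp only; omega)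
      · rfl

end GuessMode

/-! ### The languages that the machine decides -/

namespace GuessMode

variable (G : GuessMode) (dbl : Bool)

/-- The encodings of inductive instances; if the mode is exact, the dimension is fixed. -/
def languageOf : Language InSym :=
  {w | ∃ (n : ℕ) (I : InductivityInstance n), (G.exact = true → n = G.tracks) ∧ I.IsYes ∧
    I.encode (digitsOf dbl) = w}

variable {G dbl} {w : List InSym} {b : ℕ}

/-- Soundness needs no bound on the guesses: a hit counts only without overflow, and then the
registers hold the true values and `x` refutes inductivity. -/
theorem not_mem_of_stops {W : ℕ} {t : List (Fin G.tracks → Fin radix)} {x : ℕ → ℕ}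
    {p : ScanState G.tracks × List (Column G.tracks)}
    (h : Agrees W t p (evalWord dbl w x startEval)) (hs : G.stops p.1 = true) :
    w ∉ G.languageOf dbl := by
  rintro ⟨n, I, hn, hI, rfl⟩
  obtain ⟨V, h1, h2⟩ := evalWord_encode (dbl := dbl) I x
  rw [h1] at h
  have h3 := h.parse
  have h4 := h.count
  simp only at h3 h4
  have hbad : G.bad p.1 = false := by
    simp only [bad, h3, ne_eq, not_true_eq_false, decide_false, Bool.false_or,
      Bool.and_eq_false_imp, decide_eq_false_iff_not, not_not]
    intro he
    have := hn he
    omega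
  simp only [stops, hbad, Bool.false_or, Bool.and_eq_true, Bool.not_eq_true'] at hs
  obtain ⟨h5, h6⟩ := h.hit.1 hs.2
  rw [h.val hs.1, h.val hs.1] at h5 h6
  simp only at h5 h6
  have h7 := h2 false
  have h8 := h2 true
  simp only [excess, Bool.false_eq_true, if_false, if_true] at h7 h8
  refine I.not_isYes_iff.2 ⟨fun i => x i, ?_, ?_⟩ hI <;> beta_reduce <;> omega

/-- The guesses are a small refuting vector, continued by zeros as on the tracks. If `w` encodes no
instance of an admissible dimension, then the scan is stopped by `bad` whatever is guessed. -/
theorem exists_guess_of_not_mem (hw : w ∉ G.languageOf dbl) :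
    ∃ y : ℕ → ℕ, (∀ i, y i ≤ 3 * digitBound dbl w.length ^ 3) ∧
      (G.exact = true → ∀ i, G.tracks ≤ i → y i = 0) ∧
      ∀ (W : ℕ) (t : List (Fin G.tracks → Fin radix))
        (p : ScanState G.tracks × List (Column G.tracks)),
        Agrees W t p (evalWord dbl w y startEval) → p.1.2.2.1 = false → G.stops p.1 = true := by
  by_cases hI : ∃ (n : ℕ) (I : InductivityInstance n), (G.exact = true → n = G.tracks) ∧
      I.encode (digitsOf dbl) = w
  · obtain ⟨n, I, hn, rfl⟩ := hI
    have hno : ¬ I.IsYes := fun h => hw ⟨n, I, hn, h, rfl⟩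
    obtain ⟨x, hx, hb⟩ := I.exists_small_refutes (dbl := dbl) (I.not_isYes_iff.1 hno) rfl
    refine ⟨fun i => if h : i < n then x ⟨i, h⟩ else 0, fun i => ?_, fun he i hi => ?_,
      fun W t p h hov => ?_⟩
    · dsimp only
      split_ifs
      · exact hb _
      · exact Nat.zero_le _
    · have := hn he
      simp only [show ¬ i < n by omega, dif_neg, not_false_eq_true]
    · obtain ⟨V, h1, h2⟩ := evalWord_encode (dbl := dbl) I
        (fun i => if h : i < n then x ⟨i, h⟩ else 0)
      rw [h1] at h
      have hv := h.val hov
      have hhit : p.1.2.2.2 = true := by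
        rw [h.hit, hv, hv, hv, hv]
        have h7 := h2 false
        have h8 := h2 true
        simp only [excess, Bool.false_eq_true, if_false, if_true, Fin.is_lt, dif_pos,
          Fin.eta] at h7 h8
        obtain ⟨h9, h10⟩ := hx
        simp only
        omega
      simp [stops, hov, hhit]
  · refine ⟨fun _ => 0, fun _ => Nat.zero_le _, fun _ _ _ => rfl, fun W t p h _ => ?_⟩
    by_contra hs
    have hbad : G.bad p.1 = false := by
      simp only [stops, Bool.or_eq_true, not_or] at hs
      simpa using hs.1
    simp only [bad, Bool.or_eq_false_iff, decide_eq_false_iff_not, not_not] at hbad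
    have h1 := h.parse.symm.trans hbad.1
    rw [evalWord_fst] at h1
    obtain ⟨n, I, hIw⟩ := foldl_nextState_eq_finalState.1 h1
    refine hI ⟨n, I, fun he => ?_, hIw⟩
    obtain ⟨V, h2, -⟩ := evalWord_encode (dbl := dbl) I (fun _ => 0)
    have h3 := h.count
    rw [← hIw, h2] at h3
    have h4 := hbad.2
    simp only [he, Bool.true_and, decide_eq_false_iff_not, not_not] at h4
    simp only at h3
    omega

/-! ### The loop over the contents of the tracks. -/

variable (G dbl) in
/-- The state and the columns with which a scan may start. -/
def Starts (cols : List (Column G.tracks)) (p : ScanState G.tracks × List (Column G.tracks)) :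
    Prop :=
  ∃ l : List (G.Ch × Column G.tracks), l.map Prod.snd = cols ∧
    G.finish (runPass (G.pass dbl) G.resetSweep l).1 = .scan p.1 ∧
    (runPass (G.pass dbl) G.resetSweep l).2 = p.2

theorem exists_starts (cols : List (Column G.tracks)) : ∃ p, G.Starts dbl cols p := by
  obtain ⟨l, hl⟩ := G.exists_choices cols
  obtain ⟨p, h1, h2, -⟩ := G.exists_scan_of_sweepOf dbl resetOp 0 startState 0 false l
  exact ⟨p, l, hl, h1, h2⟩

theorem Starts.agrees {cols : List (Column G.tracks)}
    {p : ScanState G.tracks × List (Column G.tracks)} (h : G.Starts dbl cols p)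
    (hc : cols ≠ []) :
    Agrees cols.length (cols.map Prod.snd) p startEval ∧ p.1.2.2.1 = false := by
  obtain ⟨l, hl, h1, h2⟩ := h
  obtain ⟨q, q1, q2, -, q3, q4, q5, q6, q7, q8, q9⟩ :=
    G.exists_scan_of_sweepOf dbl resetOp 0 startState 0 false l
  have hq : q = p := by
    have e1 := q1.symm.trans h1
    have e2 := q2.symm.trans h2
    simp only [Control.scan.injEq] at e1
    exact Prod.ext e1 e2
  subst hq
  have hlen : l.length = cols.length := by rw [← hl, List.length_map]
  have hev : ∀ V x, resetOp.eval V x = startEval.2.2 := by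
    intro V x
    funext r
    rcases r with ⟨neg, after⟩ | _ | _ | _ <;> rfl
  simp only [hev] at q7 q9
  refine ⟨⟨by rw [q5, hlen], by rw [q6, hl], q3, by rw [q4]; rfl, fun h => (q7 h).2, q8⟩,
    q9 trivial fun r => ?_⟩
  have h3 : startEval.2.2 r ≤ 1 := by
    rcases r with ⟨_ | _, _ | _⟩ | _ | _ | _ <;> decide
  -- The reset sets two registers to 1, which needs at least one column.
  have h4 : 1 < radix ^ l.length := by
    refine Nat.one_lt_pow ?_ one_lt_radix
    rw [hlen]
    simpa using hc
  omega

variable (acc : Set (Control G.tracks))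

theorem exact_start {cols : List (Column G.tracks)} (hb : cols.length + 1 < b) :
    (G.machine dbl acc).toTM.Exact w b (G.between dbl acc .rewind 0 cols)
      {C | ∃ p : ScanState G.tracks × List (Column G.tracks), G.Starts dbl cols p ∧
        C = G.between dbl acc (.scan p.1) 1 p.2} := by
  convert G.exact_between dbl acc (w := w) (q := .rewind) (i := 0) (s := G.resetSweep)
    (mv := .right) rfl hb using 1
  have hmin : min (HeadMove.right.apply 0) (w.length + 1) = 1 := by
    simp [HeadMove.apply]
  rw [hmin]
  ext C
  constructor
  · rintro ⟨p, ⟨l, hl, h1, h2⟩, rfl⟩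
    obtain ⟨q, -, -, q3, -⟩ := G.exists_scan_of_sweepOf dbl resetOp 0 startState 0 false l
    refine ⟨l, hl, ?_⟩
    rw [h1, h2, show G.extend (runPass (G.pass dbl) G.resetSweep l).1 = none from q3]
    simp
  · rintro ⟨l, hl, rfl⟩
    obtain ⟨q, q1, q2, q3, -⟩ := G.exists_scan_of_sweepOf dbl resetOp 0 startState 0 false l
    refine ⟨q, ⟨l, hl, q1, q2⟩, ?_⟩
    rw [show G.extend (runPass (G.pass dbl) G.resetSweep l).1 = none from q3,
      show (runPass (G.pass dbl) G.resetSweep l).2 = _ from q2,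
      show G.finish (runPass (G.pass dbl) G.resetSweep l).1 = _ from q1]
    simp

variable (G dbl w) in
/-- Some evaluation of the input with this content of the tracks is not stopped. -/
def Passes (t : List (Fin G.tracks → Fin radix)) : Prop :=
  ∃ p x p', Agrees t.length t p startEval ∧ p.1.2.2.1 = false ∧ G.ScanRun dbl w x p p' ∧
    G.stops p'.1 = false

variable (G dbl w) in
/-- The machine has halted, because the evaluation was stopped or because the evaluation has passed
for all contents of the tracks starting with the number `k`. -/
def Finished (W k : ℕ) (C : (G.machine dbl acc).toTM.Config) : Prop :=
  ∃ q i cols, C = G.between dbl acc q i cols ∧ G.launch dbl q (inputCellAt w i) = none ∧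
    ((∃ s, q = .scan s ∧ G.stops s = true ∧ w ∉ G.languageOf dbl) ∨
      (q = .exhausted ∧ ∀ t : List (Fin G.tracks → Fin radix), t.length = W → k ≤ trackNum t →
        G.Passes dbl w t))

theorem trackNum_lt {n : ℕ} (t : List (Fin n → Fin radix)) :
    trackNum t < trackCard n ^ t.length :=
  ofDigits_map_lt (trackEquiv n) t

/-- Induction on the number of track contents that still follow the present one. All branches are
followed at once, so no determinism is required. -/
theorem leads_finished {cols : List (Column G.tracks)} (hb : cols.length + 1 < b)
    (hc : cols ≠ []) :
    (G.machine dbl acc).toTM.Leads w b (G.between dbl acc .rewind 0 cols)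
      (G.Finished dbl w acc cols.length (trackNum (cols.map Prod.snd))) := by
  have hlt := trackNum_lt (cols.map Prod.snd)
  rw [List.length_map] at hlt
  obtain ⟨d, hd⟩ : ∃ d, trackNum (cols.map Prod.snd) + (d + 1) =
      trackCard G.tracks ^ cols.length :=
    ⟨trackCard G.tracks ^ cols.length - trackNum (cols.map Prod.snd) - 1, by omega⟩
  induction d using Nat.strong_induction_on generalizing cols with
  | _ d ih =>
    refine (exact_start (dbl := dbl) acc hb).leads_of_forall (exists_starts cols) fun p hp => ?_
    obtain ⟨hag, hov⟩ := hp.agrees hc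
    have hbp : p.2.length + 1 < b := by rwa [hag.length]
    refine (G.exact_scan dbl acc w [] rfl p hbp).leads_of_forall ?_ ?_
    · obtain ⟨x, p', h⟩ := exists_scanRun (dbl := dbl) w p
      exact ⟨⟨x, p'⟩, h⟩
    rintro ⟨x, p'⟩ hrun
    have hag' := hrun.agrees hag
    by_cases hs : G.stops p'.1 = true
    · exact OfflineTM.Leads.of_self ⟨_, _, _, rfl,
        by rw [List.nil_append, inputCellAt_end]; exact if_pos hs,
        Or.inl ⟨p'.1, rfl, hs, not_mem_of_stops hag' hs⟩⟩
    have hpass : G.Passes dbl w (cols.map Prod.snd) :=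
      ⟨p, x, p', by rw [List.length_map]; exact hag, hov, hrun, by simpa using hs⟩
    obtain ⟨l, hl⟩ := G.exists_choices p'.2
    obtain ⟨carry, cols', h1, h2, h3⟩ := G.run_odo dbl true l
    have hllen : l.length = cols.length := by
      rw [← hag'.length, ← hl, List.length_map]
    rw [hl] at h1 h3
    rw [hag'.tracks, hllen, Bool.toNat_true] at h3
    have hex := G.exact_between_singleton dbl acc (w := w) (b := b) (q := .scan p'.1)
      (s := .odo true) (mv := .stay) (i := w.length + 1)
      (by rw [inputCellAt_end]; exact if_neg hs) (by rwa [hag'.length]) h1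
    simp only [HeadMove.apply, min_self, extend, Option.toList_none, List.append_nil] at hex
    have heq : ∀ t : List (Fin G.tracks → Fin radix), t.length = cols.length →
        trackNum t = trackNum (cols.map Prod.snd) → G.Passes dbl w t := by
      intro t ht ht'
      rwa [trackNum_injective (by rw [ht, List.length_map]) ht']
    refine hex.leads ?_
    cases carry
    · simp only [Bool.toNat_false, mul_zero, add_zero] at h3
      have hlt' := trackNum_lt (cols'.map Prod.snd)
      rw [List.length_map, h2, hllen] at hlt'
      have hb' : cols'.length + 1 < b := by rwa [h2, hllen]
      refine (G.exact_rewind dbl acc le_rfl hb').leads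
        ((ih (d - 1) (by omega) hb' ?_ ?_ ?_).mono ?_)
      · rintro rfl
        simp only [List.length_nil] at h2
        exact hc (List.length_eq_zero_iff.1 (by omega))
      · rwa [h2, hllen]
      · rw [h3, h2, hllen]
        omega
      -- The present content passes by `hpass`, those with larger numbers by the induction
      -- hypothesis.
      · rintro D ⟨q, i, cols'', hD, hq, h4 | ⟨h4, h5⟩⟩
        · exact ⟨q, i, cols'', hD, hq, Or.inl h4⟩
        · refine ⟨q, i, cols'', hD, hq, Or.inr ⟨h4, fun t ht hk => ?_⟩⟩
          rcases hk.eq_or_lt with hk | hk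
          · exact heq t ht hk.symm
          · exact h5 t (by rw [ht, h2, hllen]) (by rw [h3]; exact hk)
    · simp only [Bool.toNat_true, mul_one] at h3
      refine OfflineTM.Leads.of_self ⟨_, _, _, rfl, rfl, Or.inr ⟨rfl, fun t ht hk => ?_⟩⟩
      have := trackNum_lt t
      rw [ht] at this
      exact heq t ht (by omega)

variable (G dbl w) in
theorem exact_init :
    ∃ cols, Sized dbl (w.length + 1) cols ∧
      (G.machine dbl acc).toTM.Exact w (spaceBound dbl w.length + 5)
        (G.machine dbl acc).toTM.init {G.between dbl acc .rewind 0 cols} := by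
  have h0 : Sized dbl 0 ([] : List (Column G.tracks)) := by
    refine ⟨by simp, ?_⟩
    cases dbl <;> simp
  obtain ⟨cols, h1, h2⟩ := G.exact_size dbl acc (w := w) (Nat.zero_le _) h0
  refine ⟨cols, h1, ?_⟩
  rw [PassMachine.init_eq]
  exact h2.trans_singleton (G.exact_rewind dbl acc (by omega) (h1.length_lt le_rfl))

theorem _root_.Sized.ne_nil {n l : ℕ} {cols : List (Column n)} (h : Sized dbl (l + 1) cols) :
    cols ≠ [] := by
  rintro rfl
  have := h.2
  cases dbl <;> simp at this

/-- The machine halts in finished configurations. -/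
theorem exists_exact_finished (w : List InSym) :
    ∃ S W, (G.machine dbl acc).toTM.Exact w (spaceBound dbl w.length + 5)
        (G.machine dbl acc).toTM.init S ∧ S.Nonempty ∧
      (∀ D ∈ S, (G.machine dbl acc).toTM.Halted w D ∧ (∀ i, D.pos i = 0) ∧
        G.Finished dbl w acc W 0 D) ∧ digitBound dbl w.length ≤ 2 ^ W ∧ 1 ≤ W := by
  obtain ⟨cols, h1, h2⟩ := exact_init G dbl w acc
  have hb := h1.length_lt (l := w.length) le_rfl
  obtain ⟨S, h3, h4, h5⟩ := h2.leads (leads_finished (dbl := dbl) acc hb h1.ne_nil)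
  refine ⟨S, cols.length, h3, h4, fun D hD => ?_, h1.digitBound_le, ?_⟩
  · have h0 : trackNum (cols.map Prod.snd) = 0 := by
      have h6 : ∀ l : List (Fin G.tracks → Fin radix), (∀ t ∈ l, t = zeroTracks G.tracks) →
          trackNum l = 0 := by
        intro l hl
        have e : (l.map fun c => (trackEquiv G.tracks c : ℕ)) = l.map fun _ => 0 := by
          refine List.map_congr_left fun c hc => ?_
          rw [hl c hc]
          simp [zeroTracks]
        rw [trackNum, e]
        exact ofDigits_map_zero _ _
      exact h6 _ h1.1
    have h6 := h5 D hD
    rw [h0] at h6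
    obtain ⟨q, i, cols', rfl, h7, -⟩ := id h6
    exact ⟨PassMachine.halted_config h7, fun _ => rfl, h6⟩
  · exact List.length_pos_iff.2 h1.ne_nil

variable (G dbl) in
theorem runsInSpace : (G.machine dbl acc).toTM.RunsInSpace (spaceBound dbl) := by
  refine ⟨5, fun w C hC i => ?_⟩
  obtain ⟨S, W, h1, -, h2, -⟩ := exists_exact_finished (dbl := dbl) acc w
  have := h1.pos_lt (fun D hD => (h2 D hD).1) (fun D hD j => by rw [(h2 D hD).2.1 j]; omega) hC i
  omega

/-! ### Acceptance of the complement and decision of the language. -/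

/-- The space suffices for evaluating small multiplicities. -/
theorem lt_radix_pow {L W : ℕ} (hL : L ≤ 2 ^ W) (hW : 1 ≤ W) : 3 * L ^ 3 * L < radix ^ W := by
  -- Since 64 = 2⁶, there are six factors 2^W: four dominate L⁴, and two exceed the constant 3
  -- because W ≥ 1.
  have e : radix ^ W = (2 ^ W) ^ 4 * (2 ^ W) ^ 2 := by
    rw [← pow_add, ← pow_mul, mul_comm W, pow_mul]
    rfl
  have h2 : 4 ≤ (2 ^ W) ^ 2 := by
    have : 2 ^ 1 ≤ 2 ^ W := Nat.pow_le_pow_right (by norm_num) hW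
    nlinarith
  have h3 : L ^ 4 ≤ (2 ^ W) ^ 4 := Nat.pow_le_pow_left hL 4
  have h4 : 0 < (2 ^ W) ^ 4 := by positivity
  rw [e]
  calc 3 * L ^ 3 * L = 3 * L ^ 4 := by ring
    _ ≤ 3 * (2 ^ W) ^ 4 := Nat.mul_le_mul_left _ h3
    _ < (2 ^ W) ^ 4 * 4 := by omega
    _ ≤ _ := Nat.mul_le_mul_left _ h2

/-- Small guesses cause no overflow, so the conclusion of `exists_guess_of_not_mem` becomes
unconditional. -/
theorem stops_of_small {W : ℕ} (hL : digitBound dbl w.length ≤ 2 ^ W) (hW : 1 ≤ W) {y : ℕ → ℕ}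
    (hy : ∀ i, y i ≤ 3 * digitBound dbl w.length ^ 3) {t : List (Fin G.tracks → Fin radix)}
    {p p' : ScanState G.tracks × List (Column G.tracks)} (hp : Agrees W t p startEval)
    (hov : p.1.2.2.1 = false) (hrun : G.ScanRun dbl w y p p')
    (hs : Agrees W t p' (evalWord dbl w y startEval) → p'.1.2.2.1 = false →
      G.stops p'.1 = true) : G.stops p'.1 = true := by
  have hL1 : 1 ≤ digitBound dbl w.length := le_trans (by omega) (le_digitBound dbl _)
  have hL3 : digitBound dbl w.length ≤ 3 * digitBound dbl w.length ^ 3 :=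
    (Nat.le_self_pow (by norm_num) _).trans (Nat.le_mul_of_pos_left _ (by norm_num))
  refine hs (hrun.agrees hp) (hrun.no_overflow hp hov (RegBound.reset dbl (hL1.trans hL3)) ?_ hy ?_)
  · rwa [Nat.zero_add]
  · rw [Nat.zero_add]
    exact lt_radix_pow hL hW

/-- By choosing the multiplicities, the complement can be accepted. -/
theorem compl_languageOf_mem (hG : ∀ i t d, ∃ c, G.digit i c t = d) :
    (G.languageOf dbl)ᶜ ∈ NSPACE InSym (spaceBound dbl) := by
  refine ⟨(G.machine dbl {q | ∃ s, q = .scan s ∧ G.stops s = true}).toTM,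
    G.runsInSpace dbl _, ?_⟩
  ext w
  constructor
  · intro hw
    obtain ⟨S, W, h1, -, h2, -⟩ := exists_exact_finished (G := G) (dbl := dbl)
      {q | ∃ s, q = .scan s ∧ G.stops s = true} w
    obtain ⟨D, hD, hacc⟩ := (h1.accepts_iff fun D hD => (h2 D hD).1).1 hw
    obtain ⟨q, i, cols, rfl, -, ⟨s, -, -, h3⟩ | ⟨rfl, -⟩⟩ := (h2 D hD).2.2
    · exact h3
    · obtain ⟨s, hs, -⟩ := PassMachine.config_mem_accept.1 hacc
      cases hs
  · intro hw
    obtain ⟨cols, h1, h2⟩ := exact_init G dbl w {q | ∃ s, q = .scan s ∧ G.stops s = true}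
    have hb := h1.length_lt (l := w.length) le_rfl
    obtain ⟨y, hy, -, hrefute⟩ := exists_guess_of_not_mem hw
    obtain ⟨p, hp⟩ := exists_starts (dbl := dbl) cols
    obtain ⟨hag, hov⟩ := hp.agrees h1.ne_nil
    have hL := h1.digitBound_le
    have hW : 1 ≤ cols.length := List.length_pos_iff.2 h1.ne_nil
    have hL1 : 1 ≤ digitBound dbl w.length := le_trans (by omega) (le_digitBound dbl _)
    obtain ⟨p', hrun⟩ := exists_scanRun_of_choice (dbl := dbl) hG w y p (fun i => by
      rw [hag.length]
      exact ((hy i).trans (Nat.le_mul_of_pos_right _ hL1)).trans_lt (lt_radix_pow hL hW))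
    have hs := stops_of_small hL hW hy hag hov hrun (hrefute _ _ _)
    refine ⟨G.between dbl _ (.scan p'.1) (w.length + 1) p'.2, ?_, ?_, ?_⟩
    · refine (h2.1 _ rfl).trans (((exact_start (dbl := dbl) _ hb).1 _ ⟨p, hp, rfl⟩).trans ?_)
      exact (G.exact_scan dbl _ w [] rfl p (by rwa [hag.length])).1 _ ⟨⟨y, p'⟩, hrun, rfl⟩
    · refine PassMachine.halted_config ?_
      rw [inputCellAt_end]
      exact if_pos hs
    · exact PassMachine.config_mem_accept.2 ⟨_, rfl, hs⟩

theorem exists_trackVal {n W : ℕ} (y : ℕ → ℕ) (hy : ∀ i, y i < radix ^ W)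
    (h0 : ∀ i, n ≤ i → y i = 0) :
    ∃ t : List (Fin n → Fin radix), t.length = W ∧ ∀ i, trackVal t i = y i := by
  have h : ∀ i : ℕ, ∃ l : List (Fin radix), l.length = W ∧
      Nat.ofDigits radix (l.map fun c : Fin radix => (c : ℕ)) = y i := fun i =>
    exists_ofDigits_map (fun c : Fin radix => c) Function.surjective_id W (y i) (hy i)
  choose l hl hv using h
  -- The digit lists of the numbers are transposed into columns.
  refine ⟨List.ofFn fun j : Fin W => fun i : Fin n => (l i)[j]'(by rw [hl]; exact j.2), by simp,
    fun i => ?_⟩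
  by_cases hi : i < n
  · rw [trackVal, dif_pos hi, ← hv i, List.map_ofFn]
    congr 1
    refine List.ext_getElem (by simp [hl]) fun j h1 h2 => ?_
    simp
  · rw [trackVal, dif_neg hi, h0 i (by omega)]

/-- By trying all contents of the tracks, the language can be decided. -/
theorem languageOf_mem [Subsingleton G.Ch]
    (hG : ∀ i c t, G.digit i c t = if h : (i : ℕ) < G.tracks then t ⟨i, h⟩ else 0)
    (he : G.exact = true) : G.languageOf dbl ∈ DSPACE InSym (spaceBound dbl) := by
  have hsub : Subsingleton (G.machine dbl {.exhausted}).Ch := ‹Subsingleton G.Ch›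
  refine ⟨(G.machine dbl {.exhausted}).toTM, PassMachine.toTM_deterministic _, fun w => ?_,
    G.runsInSpace dbl _, ?_⟩
  · obtain ⟨S, W, h1, ⟨D, hD⟩, h2, -⟩ := exists_exact_finished (G := G) (dbl := dbl) {.exhausted} w
    exact ⟨D, h1.1 D hD, (h2 D hD).1⟩
  · ext w
    obtain ⟨S, W, h1, hne, h2, hL, hW⟩ :=
      exists_exact_finished (G := G) (dbl := dbl) {.exhausted} w
    refine (h1.accepts_iff fun D hD => (h2 D hD).1).trans ⟨?_, fun hw => ?_⟩
    · rintro ⟨D, hD, hacc⟩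
      by_contra hw
      obtain ⟨q, i, cols, rfl, -, h3⟩ := (h2 D hD).2.2
      have hq : q = .exhausted := PassMachine.config_mem_accept.1 hacc
      subst hq
      rcases h3 with ⟨s, hs, -⟩ | ⟨-, h3⟩
      · cases hs
      obtain ⟨y, hy, hy0, hrefute⟩ := exists_guess_of_not_mem hw
      have hL1 : 1 ≤ digitBound dbl w.length := le_trans (by omega) (le_digitBound dbl _)
      obtain ⟨t, ht, hty⟩ := exists_trackVal (n := G.tracks) (W := W) y (fun i =>
        ((hy i).trans (Nat.le_mul_of_pos_right _ hL1)).trans_lt (lt_radix_pow hL hW)) (hy0 he)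
      obtain ⟨p, x, p', hag, hov, hrun, hns⟩ := h3 t ht (Nat.zero_le _)
      -- The exhausted loop contains the content that holds the refuting `y`. Its passing run must
      -- have guessed exactly `y`, but then it would have been stopped.
      have hrun' := hrun.trackVal hG hag
      have e : (fun i => trackVal t (startEval.2.1 + i)) = y := by
        funext i
        rw [hty]
        simp [startEval]
      rw [e] at hrun'
      rw [ht] at hag
      rw [stops_of_small hL hW hy hag hov hrun' (hrefute _ _ _)] at hns
      cases hns
    · obtain ⟨D, hD⟩ := hne
      refine ⟨D, hD, ?_⟩
      obtain ⟨q, i, cols, rfl, -, ⟨s, -, -, h3⟩ | ⟨rfl, -⟩⟩ := (h2 D hD).2.2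
      · exact (h3 hw).elim
      · exact PassMachine.config_mem_accept.2 rfl

end GuessMode

/-! ### The two guess modes and the three complexity bounds. -/

theorem languageOf_choiceMode (dbl : Bool) :
    choiceMode.languageOf dbl = inductivityLanguage (digitsOf dbl) := by
  ext w
  constructor
  · rintro ⟨n, I, -, h1, h2⟩
    exact ⟨n, I, h1, h2⟩
  · rintro ⟨n, I, h1, h2⟩
    exact ⟨n, I, fun h => (Bool.false_ne_true h).elim, h1, h2⟩

theorem languageOf_trackMode (dbl : Bool) (n : ℕ) :
    (trackMode n).languageOf dbl = inductivityLanguageOfDim (digitsOf dbl) n := by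
  ext w
  constructor
  · rintro ⟨m, I, h, h1, h2⟩
    obtain rfl : m = n := h rfl
    exact ⟨I, h1, h2⟩
  · rintro ⟨I, h1, h2⟩
    exact ⟨n, I, fun _ => rfl, h1, h2⟩

theorem mainTheorem11 :
    (∀ n : ℕ, inductivityLanguageOfDim unaryDigits n ∈ classL InSym) ∧
      inductivityLanguage unaryDigits ∈ coClass (classNL InSym) ∧
      inductivityLanguage binaryDigits ∈ coClass (classCSL InSym) := by
  refine ⟨fun n => ?_, ?_, ?_⟩
  · have : Subsingleton (trackMode n).Ch := inferInstanceAs (Subsingleton Unit)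
    have h := GuessMode.languageOf_mem (G := trackMode n) (dbl := false) (fun _ _ _ => rfl) rfl
    rw [languageOf_trackMode] at h
    exact h
  · have h := GuessMode.compl_languageOf_mem (G := choiceMode) (dbl := false)
      (fun _ _ d => ⟨d, rfl⟩)
    rw [languageOf_choiceMode] at h
    exact h
  · have h := GuessMode.compl_languageOf_mem (G := choiceMode) (dbl := true)
      (fun _ _ d => ⟨d, rfl⟩)
    rw [languageOf_choiceMode] at h
    exact h
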